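/- Let the tower of twos of height $k$ be defined by $T(0)=1$ and $T(k+1)=2^{T(k)}$. Let $H$ be a finite simple graph on $h\ge 1$ vertices and let $0<\varepsilon<1$; if $H$ has no edges, assume moreover that $\varepsilon<1/2$. Let $\delta>0$ be given by $$\delta^{-1}=T\big(\lfloor 5h^4\log(1/\varepsilon)\rfloor\big),$$ where $\log$ is the natural logarithm. Then every finite simple graph $G$ on $n$ vertices that contains at most $\delta n^h$ copies of $H$ (that is, at most $\delta n^h$ not necessarily induced subgraphs isomorphic to $H$) can be made $H$-free by deleting at most $\varepsilon n^2$ of its edges. -/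

import Mathlib

/-- The tower of twos of height `k`: `2 ^ (2 ^ (⋯ ^ 2))` with `k` twos (and `1` for `k = 0`). -/
def towerOfTwos : ℕ → ℕ
  | 0 => 1
  | k + 1 => 2 ^ towerOfTwos k

set_option linter.unusedSectionVars false

/-! Suppose that no set of at most εn² edges meets all copies of H. A maximal family F of
edge-disjoint copies then uses a set E of |F|Δ > 2εn² ordered pairs, where Δ is the number of darts
of H. For a vertex partition P, sum log d(x) over x ∈ E, where d(x) is the density of E in the cell
of x (`logSum`). This is at most 0, and it is |E| log(|E|/n²) for the trivial partition. If H has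
few homomorphisms into E, every P has a refinement that raises the sum by |F|/(4Δ) = |E|/(4Δ²)
(`exists_refinement`). So there are at most 4Δ² log(n²/|E|) ≤ 4h⁴ log(1/(2ε)) refinements, each
exponential in the number of parts; this logarithmic count gives the tower height.

For one refinement, edge-disjointness shows that at most a quarter of F uses light pairs of parts.
Any other copy lies in a box of parts containing few homomorphisms. By the counting lemma such a box
contains a large sparse pair (`exists_sparse_pair`). Cutting such pairs out repeatedly covers most
of the box (`exists_sparseFamily`). Pigeonhole over darts and averaging over two-dimensional slices
then give one pair of parts, of density at least 8α, with a subset of relative size 3/(4Δ) where E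
has density at most α, described by boundedly many colours (`exists_sparse_region`). Refining by
these colours raises the sum, by concavity of the logarithm (`logSum_refine`, `Shattered.gain`).

Finally, few copies mean few homomorphisms (`card_homs_le_of_copies`), a contradiction. For edgeless
H, the copies are simply too numerous unless n < h (`free_of_bot`). -/

namespace GraphRemoval
-- Counting lemma for lower regular boxes
section
open scoped Classical
open Finset

variable {V W : Type*} [Fintype W]

/-- The maps `x` into the box `B` which send every edge of `H` inside `S` to an element of `E`. -/
noncomputable def homsOn (H : SimpleGraph W) (E : Finset (V × V)) (S : Finset W)
    (B : W → Finset V) : Finset (W → V) :=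
  (Fintype.piFinset B).filter fun x => ∀ i ∈ S, ∀ j ∈ S, H.Adj i j → (x i, x j) ∈ E

lemma mem_homsOn {H : SimpleGraph W} {E : Finset (V × V)} {S : Finset W} {B : W → Finset V}
    {x : W → V} : x ∈ homsOn H E S B ↔
      (∀ i, x i ∈ B i) ∧ ∀ i ∈ S, ∀ j ∈ S, H.Adj i j → (x i, x j) ∈ E := by
  simp [homsOn, Fintype.mem_piFinset]

/-- Large subsets of the parts belonging to an edge of `H` inside `S` span density above `α`. -/
def LowerRegular (H : SimpleGraph W) (E : Finset (V × V)) (η α : ℝ) (S : Finset W)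
    (B : W → Finset V) : Prop :=
  ∀ i ∈ S, ∀ j ∈ S, H.Adj i j → ∀ C ⊆ B i, ∀ D ⊆ B j,
    η * (B i).card ≤ C.card → η * (B j).card ≤ D.card →
      α * (C.card * D.card) < ((E ∩ C ×ˢ D).card : ℝ)

lemma card_inter_product_le_of_degree {E : Finset (V × V)} {C D : Finset V} {c : ℝ}
    (h : ∀ u ∈ C, ((D.filter fun v => (u, v) ∈ E).card : ℝ) ≤ c) :
    ((E ∩ C ×ˢ D).card : ℝ) ≤ C.card * c := by
  have h1 : (E ∩ C ×ˢ D).card = ∑ u ∈ C, (D.filter fun v => (u, v) ∈ E).card := by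
    have : E ∩ C ×ˢ D = (C ×ˢ D).filter (fun p => p ∈ E) := by
      ext p; simp [and_comm]
    rw [this, card_filter, sum_product]
    exact sum_congr rfl fun u _ => by rw [card_filter]
  rw [h1, Nat.cast_sum, ← nsmul_eq_mul]
  exact sum_le_card_nsmul _ _ _ h

/-- Otherwise the low-degree vertices and the whole of `B j` would form a large pair of density at
most `α`. -/
lemma LowerRegular.card_low_degree_lt {H : SimpleGraph W} {E : Finset (V × V)} {η α : ℝ}
    {S : Finset W} {B : W → Finset V} (h : LowerRegular H E η α S B) (hη : η ≤ 1)
    {i j : W} (hi : i ∈ S) (hj : j ∈ S) (hij : H.Adj i j) :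
    (((B i).filter fun u => (((B j).filter fun v => (u, v) ∈ E).card : ℝ)
      ≤ α * (B j).card).card : ℝ) < η * (B i).card := by
  by_contra! hc
  refine (h i hi j hj hij _ (filter_subset _ _) (B j) subset_rfl hc ?_).not_ge ?_
  · exact mul_le_of_le_one_left (by positivity) hη
  · refine (card_inter_product_le_of_degree (c := α * (B j).card) ?_).trans_eq (by ring)
    intro u hu
    exact (mem_filter.1 hu).2

/-- The box obtained from `B` by fixing the value `u` at `i` and restricting the parts of the
neighbours of `i` to the neighbours of `u`. -/
noncomputable def linkBox (H : SimpleGraph W) (E : Finset (V × V)) (S : Finset W)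
    (B : W → Finset V) (i : W) (u : V) (j : W) : Finset V :=
  if j = i then {u} else if j ∈ S ∧ H.Adj i j then (B j).filter fun v => (u, v) ∈ E else B j

/-- Each restricted part keeps an `α` fraction, so an `η / α` fraction of it is still an `η`
fraction of the original part. -/
lemma LowerRegular.link {H : SimpleGraph W} {E : Finset (V × V)} {η α : ℝ}
    {S : Finset W} {B : W → Finset V} {i : W} (hi : i ∉ S)
    (h : LowerRegular H E η α (insert i S) B) (hα0 : 0 < α) (hα1 : α ≤ 1) (hη : 0 ≤ η) {u : V}
    (hu : ∀ j ∈ S, H.Adj i j → α * (B j).card ≤ (((B j).filter fun v => (u, v) ∈ E).card : ℝ)) :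
    LowerRegular H E (η / α) α S (linkBox H E S B i u) := by
  have key : ∀ j ∈ S, linkBox H E S B i u j ⊆ B j ∧
      η * (B j).card ≤ η / α * (linkBox H E S B i u j).card := by
    intro j hj
    have hji : j ≠ i := fun e => hi (e ▸ hj)
    rw [div_mul_eq_mul_div, le_div_iff₀ hα0, mul_assoc]
    by_cases hij : H.Adj i j
    · simp only [linkBox, hji, if_false, hj, hij, and_self, if_true]
      refine ⟨filter_subset _ _, mul_le_mul_of_nonneg_left ?_ hη⟩
      rw [mul_comm]; exact hu j hj hij
    · simp only [linkBox, hji, if_false, hij, and_false]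
      exact ⟨subset_rfl, mul_le_mul_of_nonneg_left
        (mul_le_of_le_one_right (by positivity) hα1) hη⟩
  intro j hj k hk hjk C hC D hD hC' hD'
  exact h j (mem_insert_of_mem hj) k (mem_insert_of_mem hk) hjk C (hC.trans (key j hj).1) D
    (hD.trans (key k hk).1) ((key j hj).2.trans hC') ((key k hk).2.trans hD')

lemma prod_card_linkBox_ge {H : SimpleGraph W} {E : Finset (V × V)} {α : ℝ}
    {S : Finset W} {B : W → Finset V} {i : W} (hα0 : 0 ≤ α) (hα1 : α ≤ 1) {u : V}
    (hu : ∀ j ∈ S, H.Adj i j → α * (B j).card ≤ (((B j).filter fun v => (u, v) ∈ E).card : ℝ)) :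
    α ^ Fintype.card W * ∏ j ∈ univ.erase i, ((B j).card : ℝ)
      ≤ ∏ j, ((linkBox H E S B i u j).card : ℝ) := by
  rw [← mul_prod_erase univ _ (mem_univ i)]
  have h1 : ((linkBox H E S B i u i).card : ℝ) = 1 := by simp [linkBox]
  rw [h1, one_mul]
  calc α ^ Fintype.card W * ∏ j ∈ univ.erase i, ((B j).card : ℝ)
      ≤ α ^ (univ.erase i).card * ∏ j ∈ univ.erase i, ((B j).card : ℝ) :=
        mul_le_mul_of_nonneg_right
          (pow_le_pow_of_le_one hα0 hα1 (card_le_univ _)) (by positivity)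
    _ = ∏ j ∈ univ.erase i, (α * ((B j).card : ℝ)) := by rw [prod_mul_distrib, prod_const]
    _ ≤ _ := by
      refine prod_le_prod (fun _ _ => by positivity) fun j hj => ?_
      have hji : j ≠ i := ne_of_mem_erase hj
      by_cases hij : j ∈ S ∧ H.Adj i j
      · simp only [linkBox, hji, if_false, hij, and_self, if_true]
        exact hu j hij.1 hij.2
      · simp only [linkBox, hji, if_false, hij]
        exact mul_le_of_le_one_left (by positivity) hα1

lemma homsOn_linkBox_subset {H : SimpleGraph W} {E : Finset (V × V)}
    (hE : ∀ u v, (u, v) ∈ E → (v, u) ∈ E)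
    {S : Finset W} {B : W → Finset V} {i : W} {u : V} (hu : u ∈ B i) :
    homsOn H E S (linkBox H E S B i u) ⊆ (homsOn H E (insert i S) B).filter fun x => x i = u := by
  intro x hx
  rw [mem_homsOn] at hx
  obtain ⟨hx, hxE⟩ := hx
  have hxi : x i = u := by simpa [linkBox] using hx i
  have hadj : ∀ j ∈ S, H.Adj i j → (u, x j) ∈ E := by
    intro j hj hij
    have := hx j
    simp only [linkBox, hij.ne', if_false, hj, hij, and_self, if_true] at this
    exact (mem_filter.1 this).2
  rw [mem_filter, mem_homsOn]
  refine ⟨⟨fun j => ?_, ?_⟩, hxi⟩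
  · have := hx j
    by_cases hji : j = i
    · rw [hji, hxi]; exact hu
    · simp only [linkBox, hji, if_false] at this
      split_ifs at this
      · exact (mem_filter.1 this).1
      · exact this
  · intro j hj k hk hjk
    rcases mem_insert.1 hj with hj' | hj'
    · rcases mem_insert.1 hk with hk' | hk'
      · exact absurd (hj'.trans hk'.symm) hjk.ne
      · rw [hj', hxi]; exact hadj k hk' (hj' ▸ hjk)
    · rcases mem_insert.1 hk with hk' | hk'
      · rw [hk', hxi]; exact hE _ _ (hadj j hj' (hk' ▸ hjk.symm))
      · exact hxE j hj' k hk' hjk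

/-- The counting lemma for lower regular boxes. -/
lemma LowerRegular.card_homsOn_ge {H : SimpleGraph W} {E : Finset (V × V)}
    (hE : ∀ u v, (u, v) ∈ E → (v, u) ∈ E) {α : ℝ} (hα0 : 0 < α) (hα1 : α ≤ 1) (S : Finset W) :
    ∀ (η : ℝ) (B : W → Finset V), 0 ≤ η → 2 * Fintype.card W * η ≤ α ^ S.card →
      LowerRegular H E η α S B →
      (α ^ Fintype.card W / 2) ^ S.card * ∏ j, ((B j).card : ℝ) ≤ (homsOn H E S B).card := by
  induction S using Finset.induction_on with
  | empty =>
    intro η B _ _ _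
    simp [homsOn, Fintype.card_piFinset]
  | insert i S hi ih =>
    intro η B hη0 hη h
    have hW : (1 : ℝ) ≤ Fintype.card W := by
      exact_mod_cast Fintype.card_pos_iff.2 ⟨i⟩
    have hWη : 2 * Fintype.card W * η ≤ 1 := hη.trans (pow_le_one₀ hα0.le hα1)
    have hη1 : η ≤ 1 := by
      refine le_trans (le_mul_of_one_le_left hη0 ?_) hWη
      linarith
    have hP : 0 ≤ (α ^ Fintype.card W / 2) ^ S.card *
        (α ^ Fintype.card W * ∏ j ∈ univ.erase i, ((B j).card : ℝ)) := by positivity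
    have hQ : 0 ≤ (α ^ Fintype.card W / 2) ^ S.card := by positivity
    set bad : W → Finset V := fun j => (B i).filter fun u =>
      (((B j).filter fun v => (u, v) ∈ E).card : ℝ) ≤ α * (B j).card with hbad
    set N : Finset W := S.filter fun j => H.Adj i j with hN
    -- Each neighbour of `i` in `S` rules out at most `η |B i|` values, and `|W| η ≤ 1/2`, so half
    -- of the part survives.
    set good : Finset V := B i \ N.biUnion bad with hgood
    have hgood_card : ((B i).card : ℝ) / 2 ≤ good.card := by
      have h1 : ((N.biUnion bad).card : ℝ) ≤ Fintype.card W * (η * (B i).card) := by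
        calc ((N.biUnion bad).card : ℝ) ≤ ∑ j ∈ N, ((bad j).card : ℝ) := by
              exact_mod_cast card_biUnion_le
          _ ≤ N.card • (η * (B i).card) := by
              refine sum_le_card_nsmul _ _ _ fun j hj => ?_
              obtain ⟨hj, hij⟩ := mem_filter.1 hj
              exact (h.card_low_degree_lt hη1 (mem_insert_self _ _)
                (mem_insert_of_mem hj) hij).le
          _ ≤ Fintype.card W * (η * (B i).card) := by
              rw [nsmul_eq_mul]
              refine mul_le_mul_of_nonneg_right ?_ (by positivity)
              exact_mod_cast card_le_univ _
      have h2 : ((B i).card : ℝ) ≤ good.card + (N.biUnion bad).card := by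
        exact_mod_cast (Nat.sub_le_iff_le_add.1 (le_card_sdiff (N.biUnion bad) (B i)))
      have h3 : (Fintype.card W : ℝ) * (η * (B i).card) ≤ (B i).card / 2 := by
        have : (2 * Fintype.card W * η) * ((B i).card : ℝ) ≤ (B i).card :=
          mul_le_of_le_one_left (Nat.cast_nonneg _) hWη
        linarith
      linarith
    have hdeg : ∀ u ∈ good, ∀ j ∈ S, H.Adj i j →
        α * (B j).card ≤ (((B j).filter fun v => (u, v) ∈ E).card : ℝ) := by
      intro u hu j hj hij
      by_contra! hc
      refine (mem_sdiff.1 hu).2 (mem_biUnion.2 ⟨j, mem_filter.2 ⟨hj, hij⟩, ?_⟩)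
      exact mem_filter.2 ⟨(mem_sdiff.1 hu).1, hc.le⟩
    have hone : ∀ u ∈ good, (α ^ Fintype.card W / 2) ^ S.card *
        (α ^ Fintype.card W * ∏ j ∈ univ.erase i, ((B j).card : ℝ))
        ≤ (((homsOn H E (insert i S) B).filter fun x => x i = u).card : ℝ) := by
      intro u hu
      calc _ ≤ (α ^ Fintype.card W / 2) ^ S.card *
            ∏ j, ((linkBox H E S B i u j).card : ℝ) :=
            mul_le_mul_of_nonneg_left (prod_card_linkBox_ge hα0.le hα1 (hdeg u hu)) hQ
        _ ≤ (homsOn H E S (linkBox H E S B i u)).card := by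
            -- One factor `α` in the bound on `η` pays for the passage from `η` to `η / α`.
            refine ih (η / α) _ (div_nonneg hη0 hα0.le) ?_ (h.link hi hα0 hα1 hη0 (hdeg u hu))
            rw [card_insert_of_notMem hi, pow_succ] at hη
            rw [← mul_div_assoc, div_le_iff₀ hα0]
            exact hη
        _ ≤ _ := by
            exact_mod_cast card_le_card (homsOn_linkBox_subset hE (mem_sdiff.1 hu).1)
    calc (α ^ Fintype.card W / 2) ^ (insert i S).card * ∏ j, ((B j).card : ℝ)
        = ((B i).card / 2) * ((α ^ Fintype.card W / 2) ^ S.card *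
          (α ^ Fintype.card W * ∏ j ∈ univ.erase i, ((B j).card : ℝ))) := by
          rw [card_insert_of_notMem hi, pow_succ,
            ← mul_prod_erase univ (fun j => ((B j).card : ℝ)) (mem_univ i)]
          ring
      _ ≤ good.card * ((α ^ Fintype.card W / 2) ^ S.card *
          (α ^ Fintype.card W * ∏ j ∈ univ.erase i, ((B j).card : ℝ))) :=
          mul_le_mul_of_nonneg_right hgood_card hP
      _ ≤ ∑ u ∈ good, (((homsOn H E (insert i S) B).filter fun x => x i = u).card : ℝ) := by
          rw [← nsmul_eq_mul]
          exact card_nsmul_le_sum _ _ _ hone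
      _ ≤ (homsOn H E (insert i S) B).card := by
          have h1 : ∀ x ∈ homsOn H E (insert i S) B, x i ∈ B i :=
            fun x hx => (mem_homsOn.1 hx).1 i
          rw [card_eq_sum_card_fiberwise (f := fun x : W → V => x i) h1, Nat.cast_sum]
          exact sum_le_sum_of_subset_of_nonneg sdiff_subset fun _ _ _ => Nat.cast_nonneg _

/-- A box with few homomorphisms contains a large pair of low density. -/
lemma exists_sparse_pair {H : SimpleGraph W} {E : Finset (V × V)}
    (hE : ∀ u v, (u, v) ∈ E → (v, u) ∈ E) {α η : ℝ} (hα0 : 0 < α) (hα1 : α ≤ 1)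
    (hη0 : 0 ≤ η) (hη : 2 * Fintype.card W * η ≤ α ^ Fintype.card W) {B : W → Finset V}
    (hB : ((homsOn H E univ B).card : ℝ) <
      (α ^ Fintype.card W / 2) ^ Fintype.card W * ∏ j, ((B j).card : ℝ)) :
    ∃ i j, H.Adj i j ∧ ∃ C ⊆ B i, ∃ D ⊆ B j, η * (B i).card ≤ C.card ∧
      η * (B j).card ≤ D.card ∧ ((E ∩ C ×ˢ D).card : ℝ) ≤ α * (C.card * D.card) := by
  by_contra! hc
  refine hB.not_ge ?_
  have := LowerRegular.card_homsOn_ge hE hα0 hα1 univ η B hη0 (by simpa using hη)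
    (fun i _ j _ hij C hC D hD h1 h2 => hc i j hij C hC D hD h1 h2)
  simpa using this

end

/-! ### Covering a box by sparse boxes, and slicing -/

section
open scoped Classical
open Finset Function

variable {V W : Type*} [Fintype W]

lemma exists_fin_coloring {ι : Type*} [Fintype ι] (c : V → ι) {k : ℕ} (h : Fintype.card ι ≤ k) :
    ∃ c' : V → Fin k, ∀ u v, c' u = c' v → c u = c v :=
  ⟨fun v => Fin.castLE h (Fintype.equivFin ι (c v)), fun _ _ huv =>
    (Fintype.equivFin ι).injective (Fin.castLE_injective h huv)⟩

lemma piFinset_update_union {B : W → Finset V} {i : W} {C : Finset V} (hC : C ⊆ B i) :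
    Fintype.piFinset (update B i C) ∪ Fintype.piFinset (update B i (B i \ C)) =
      Fintype.piFinset B := by
  ext x
  simp only [mem_union, Fintype.mem_piFinset]
  constructor
  · rintro (h | h) j
    · by_cases hj : j = i
      · subst hj; exact hC (by simpa using h j)
      · simpa [hj] using h j
    · by_cases hj : j = i
      · subst hj; exact (mem_sdiff.1 (by simpa using h j)).1
      · simpa [hj] using h j
  · intro h
    by_cases hx : x i ∈ C
    · left
      intro j
      by_cases hj : j = i
      · subst hj; simpa using hx
      · simpa [hj] using h j
    · right
      intro j
      by_cases hj : j = i
      · subst hj; simpa [hx] using h j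
      · simpa [hj] using h j

lemma disjoint_piFinset_update (B : W → Finset V) (i : W) (C : Finset V) :
    Disjoint (Fintype.piFinset (update B i C)) (Fintype.piFinset (update B i (B i \ C))) := by
  rw [Finset.disjoint_left]
  intro x h h'
  have h1 := Fintype.mem_piFinset.1 h i
  have h2 := Fintype.mem_piFinset.1 h' i
  simp only [update_self, mem_sdiff] at h1 h2
  exact h2.2 h1

lemma card_homsOn_update_add {H : SimpleGraph W} {E : Finset (V × V)} {S : Finset W}
    {B : W → Finset V} {i : W} {C : Finset V} (hC : C ⊆ B i) :
    (homsOn H E S (update B i C)).card + (homsOn H E S (update B i (B i \ C))).card =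
      (homsOn H E S B).card := by
  rw [homsOn, homsOn, homsOn, ← piFinset_update_union hC, filter_union, card_union_of_disjoint]
  exact disjoint_filter_filter (disjoint_piFinset_update B i C)

lemma prod_card_update_add {B : W → Finset V} {i : W} {C : Finset V} (hC : C ⊆ B i) :
    ∏ j, ((update B i C j).card : ℝ) + ∏ j, ((update B i (B i \ C) j).card : ℝ) =
      ∏ j, ((B j).card : ℝ) := by
  have := congrArg card (piFinset_update_union hC)
  rw [card_union_of_disjoint (disjoint_piFinset_update B i C), Fintype.card_piFinset,
    Fintype.card_piFinset, Fintype.card_piFinset] at this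
  exact_mod_cast this

lemma prod_card_update_ge {B : W → Finset V} {i : W} {C : Finset V} {η : ℝ}
    (hC : η * (B i).card ≤ C.card) :
    η * ∏ j, ((B j).card : ℝ) ≤ ∏ j, ((update B i C j).card : ℝ) := by
  rw [← mul_prod_erase univ _ (mem_univ i),
    ← mul_prod_erase univ (fun j => ((update B i C j).card : ℝ)) (mem_univ i), ← mul_assoc]
  have : ∏ j ∈ univ.erase i, ((update B i C j).card : ℝ) =
      ∏ j ∈ univ.erase i, ((B j).card : ℝ) :=
    prod_congr rfl fun j hj => by rw [update_of_ne (ne_of_mem_erase hj)]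
  rw [this, update_self]
  exact mul_le_mul_of_nonneg_right hC (by positivity)

/-- Replace the values of `x` at `i` and `j`. -/
noncomputable def replace (x : W → V) (i j : W) (p : V × V) : W → V :=
  update (update x i p.1) j p.2

lemma replace_left {x : W → V} {i j : W} (hij : i ≠ j) (p : V × V) : replace x i j p i = p.1 := by
  simp [replace, hij]

lemma replace_right (x : W → V) (i j : W) (p : V × V) : replace x i j p j = p.2 := by
  simp [replace]

lemma replace_of_ne {x : W → V} {i j l : W} (hi : l ≠ i) (hj : l ≠ j) (p : V × V) :
    replace x i j p l = x l := by
  simp [replace, hi, hj]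

lemma replace_replace {x : W → V} {i j : W} (hij : i ≠ j) (p : V × V) :
    replace (replace x i j p) i j (x i, x j) = x := by
  ext l
  by_cases hj : l = j
  · subst hj; rw [replace_right]
  by_cases hi : l = i
  · subst hi; rw [replace_left hij]
  rw [replace_of_ne hi hj, replace_of_ne hi hj]

variable [Fintype V]

/-- The two-dimensional slice through `x` of a set of maps, in the coordinates `i` and `j`. -/
noncomputable def slice (X : Finset (W → V)) (x : W → V) (i j : W) : Finset (V × V) :=
  univ.filter fun p => replace x i j p ∈ X

lemma mem_slice {X : Finset (W → V)} {x : W → V} {i j : W} {p : V × V} :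
    p ∈ slice X x i j ↔ replace x i j p ∈ X := by simp [slice]

lemma slice_union (X Y : Finset (W → V)) (x : W → V) (i j : W) :
    slice (X ∪ Y) x i j = slice X x i j ∪ slice Y x i j := by
  ext p; simp [mem_slice]

lemma disjoint_slice {X Y : Finset (W → V)} (h : Disjoint X Y) (x : W → V) (i j : W) :
    Disjoint (slice X x i j) (slice Y x i j) := by
  rw [Finset.disjoint_left] at h ⊢
  intro p hp hq
  exact h (mem_slice.1 hp) (mem_slice.1 hq)

/-- All the slices of `X` in the directions `i` and `j` have density at most `α`. -/
def SparseSlices (E : Finset (V × V)) (α : ℝ) (X : Finset (W → V)) (i j : W) : Prop :=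
  ∀ x, ((E ∩ slice X x i j).card : ℝ) ≤ α * (slice X x i j).card

lemma SparseSlices.empty (E : Finset (V × V)) (α : ℝ) (i j : W) :
    SparseSlices E α (∅ : Finset (W → V)) i j := by
  intro x; simp [slice]

/-- Numerators and denominators of slice densities both add over disjoint sets. -/
lemma SparseSlices.union {E : Finset (V × V)} {α : ℝ} {X Y : Finset (W → V)} {i j : W}
    (hX : SparseSlices E α X i j) (hY : SparseSlices E α Y i j) (h : Disjoint X Y) :
    SparseSlices E α (X ∪ Y) i j := by
  intro x
  have hd := disjoint_slice h x i j
  rw [slice_union, inter_union_distrib_left, card_union_of_disjoint hd,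
    card_union_of_disjoint (hd.mono inter_subset_right inter_subset_right)]
  push_cast
  linarith [hX x, hY x]

/-- A slice is `C ×ˢ D` or empty, according to whether the other coordinates of `x` lie in their
parts. -/
lemma SparseSlices.box {E : Finset (V × V)} {α : ℝ} {i j : W} (hij : i ≠ j) {B : W → Finset V}
    {C D : Finset V} (hCD : ((E ∩ C ×ˢ D).card : ℝ) ≤ α * (C.card * D.card)) :
    SparseSlices E α (Fintype.piFinset (update (update B i C) j D)) i j := by
  intro x
  by_cases hx : ∀ l, l ≠ i → l ≠ j → x l ∈ B l
  · have : slice (Fintype.piFinset (update (update B i C) j D)) x i j = C ×ˢ D := by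
      ext p
      rw [mem_slice, Fintype.mem_piFinset, mem_product]
      constructor
      · intro h
        have h1 := h i
        have h2 := h j
        rw [replace_left hij, update_of_ne hij, update_self] at h1
        rw [replace_right, update_self] at h2
        exact ⟨h1, h2⟩
      · intro h l
        by_cases hj : l = j
        · subst hj; rw [replace_right, update_self]; exact h.2
        by_cases hi : l = i
        · subst hi; rw [replace_left hij, update_of_ne hij, update_self]; exact h.1
        rw [replace_of_ne hi hj, update_of_ne hj, update_of_ne hi]
        exact hx l hi hj
    rw [this, card_product]
    exact_mod_cast hCD
  · push Not at hx
    obtain ⟨l, hi, hj, hl⟩ := hx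
    have : slice (Fintype.piFinset (update (update B i C) j D)) x i j = ∅ := by
      rw [eq_empty_iff_forall_notMem]
      intro p hp
      rw [mem_slice, Fintype.mem_piFinset] at hp
      have := hp l
      rw [replace_of_ne hi hj, update_of_ne hj, update_of_ne hi] at this
      exact hl this
    simp [this]

/-- A family of disjoint sets of maps in the box `B`, one for each dart of `H`, with sparse slices
and determined by a colouring of the vertices by `k` colours. -/
structure SparseFamily (H : SimpleGraph W) (E : Finset (V × V)) (α : ℝ) (k : ℕ)
    (B : W → Finset V) (L : W → W → Finset (W → V)) : Prop where
  subset : ∀ i j, L i j ⊆ Fintype.piFinset B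
  eq_empty : ∀ i j, ¬ H.Adj i j → L i j = ∅
  sparse : ∀ i j, SparseSlices E α (L i j) i j
  coloring : ∃ c : V → Fin k, ∀ i j x y, (∀ l, c (x l) = c (y l)) → (x ∈ L i j ↔ y ∈ L i j)

lemma SparseFamily.empty (H : SimpleGraph W) (E : Finset (V × V)) (α : ℝ) {k : ℕ} (hk : 0 < k)
    (B : W → Finset V) : SparseFamily H E α k B fun _ _ => ∅ where
  subset _ _ := empty_subset _
  eq_empty _ _ _ := rfl
  sparse _ _ := SparseSlices.empty _ _ _ _
  coloring := ⟨fun _ => ⟨0, hk⟩, by simp⟩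

lemma SparseFamily.union {H : SimpleGraph W} {E : Finset (V × V)} {α : ℝ} {k₁ k₂ : ℕ}
    {B B₁ B₂ : W → Finset V} {L₁ L₂ : W → W → Finset (W → V)}
    (h₁ : SparseFamily H E α k₁ B₁ L₁) (h₂ : SparseFamily H E α k₂ B₂ L₂)
    (hB : Fintype.piFinset B₁ ∪ Fintype.piFinset B₂ = Fintype.piFinset B)
    (hd : Disjoint (Fintype.piFinset B₁) (Fintype.piFinset B₂)) :
    SparseFamily H E α (k₁ * k₂) B (fun i j => L₁ i j ∪ L₂ i j) where
  subset i j := (union_subset_union (h₁.subset i j) (h₂.subset i j)).trans hB.le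
  eq_empty i j hij := by simp [h₁.eq_empty i j hij, h₂.eq_empty i j hij]
  sparse i j := (h₁.sparse i j).union (h₂.sparse i j)
    (hd.mono (h₁.subset i j) (h₂.subset i j))
  coloring := by
    obtain ⟨c₁, hc₁⟩ := h₁.coloring
    obtain ⟨c₂, hc₂⟩ := h₂.coloring
    obtain ⟨c, hc⟩ := exists_fin_coloring (fun v => (c₁ v, c₂ v)) (k := k₁ * k₂) (by simp)
    refine ⟨c, fun i j x y hxy => ?_⟩
    have := fun l => Prod.ext_iff.1 (hc _ _ (hxy l))
    rw [mem_union, mem_union, hc₁ i j x y fun l => (this l).1, hc₂ i j x y fun l => (this l).2]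

/-- One bit per coordinate records membership in the corresponding part, whence `2 ^ |W|` colours.
-/
lemma SparseFamily.box {H : SimpleGraph W} {E : Finset (V × V)} {α : ℝ} {i j : W}
    (hij : H.Adj i j) {B : W → Finset V}
    {C D : Finset V} (hCD : ((E ∩ C ×ˢ D).card : ℝ) ≤ α * (C.card * D.card)) :
    SparseFamily H E α (2 ^ Fintype.card W) (update (update B i C) j D) (fun a b =>
      if a = i ∧ b = j then Fintype.piFinset (update (update B i C) j D) else ∅) where
  subset a b := by split_ifs <;> simp
  eq_empty a b hab := by
    rw [if_neg]
    rintro ⟨rfl, rfl⟩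
    exact hab hij
  sparse a b := by
    split_ifs with h
    · obtain ⟨rfl, rfl⟩ := h
      exact SparseSlices.box hij.ne hCD
    · exact SparseSlices.empty _ _ _ _
  coloring := by
    obtain ⟨c, hc⟩ := exists_fin_coloring (k := 2 ^ Fintype.card W)
      (fun v : V => fun l : W => decide (v ∈ update (update B i C) j D l)) (by simp)
    refine ⟨c, fun a b x y hxy => ?_⟩
    split_ifs
    · rw [Fintype.mem_piFinset, Fintype.mem_piFinset]
      refine forall_congr' fun l => ?_
      simpa using congrFun (hc _ _ (hxy l)) l
    · simp

/-- A box with few homomorphisms is mostly covered by a sparse family. -/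
lemma exists_sparseFamily {H : SimpleGraph W} {E : Finset (V × V)}
    (hE : ∀ u v, (u, v) ∈ E → (v, u) ∈ E) {α η κ : ℝ} (hα0 : 0 < α) (hα1 : α ≤ 1)
    (hη0 : 0 ≤ η) (hη1 : η ≤ 1) (hη : 2 * Fintype.card W * η ≤ α ^ Fintype.card W)
    (hκ : κ = (α ^ Fintype.card W / 2) ^ Fintype.card W) (r : ℕ) :
    ∀ B : W → Finset V, ∃ L, SparseFamily H E α (2 ^ (Fintype.card W * (2 ^ r - 1))) B L ∧
      ∏ j, ((B j).card : ℝ) ≤ ∑ i, ∑ j, ((L i j).card : ℝ) +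
        (1 - η ^ 2) ^ r * ∏ j, ((B j).card : ℝ) + (homsOn H E univ B).card / κ := by
  have hκ0 : 0 < κ := by rw [hκ]; positivity
  have hρ : 0 ≤ 1 - η ^ 2 := by nlinarith
  induction r with
  | zero =>
    intro B
    refine ⟨_, SparseFamily.empty H E α (by positivity) B, ?_⟩
    simp only [card_empty, Nat.cast_zero, sum_const_zero, pow_zero, one_mul, zero_add]
    linarith [show 0 ≤ ((homsOn H E univ B).card : ℝ) / κ by positivity]
  | succ r ih =>
    intro B
    -- A box rich in homomorphisms stays uncovered. Its volume is charged to the last term; such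
    -- charges add up over disjoint boxes.
    by_cases hB : κ * ∏ j, ((B j).card : ℝ) ≤ (homsOn H E univ B).card
    · refine ⟨_, SparseFamily.empty H E α (by positivity) B, ?_⟩
      simp only [card_empty, Nat.cast_zero, sum_const_zero, zero_add]
      have h1 : ∏ j, ((B j).card : ℝ) ≤ (homsOn H E univ B).card / κ := by
        rw [le_div_iff₀ hκ0]; linarith
      have h2 : 0 ≤ (1 - η ^ 2) ^ (r + 1) * ∏ j, ((B j).card : ℝ) := by positivity
      linarith
    · push Not at hB
      rw [hκ] at hB
      -- The box splits into the sparse box on `C`, `D`, of relative volume at least `η ^ 2`, and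
      -- two remainders: `i`-th coordinate outside `C`, or inside `C` with `j`-th coordinate outside
      -- `D`.
      obtain ⟨i, j, hij, C, hC, D, hD, hC', hD', hCD⟩ :=
        exists_sparse_pair hE hα0 hα1 hη0 hη hB
      have hji : j ≠ i := hij.ne'
      set B' := update B i C with hB'
      have hB'j : B' j = B j := by rw [hB', update_of_ne hji]
      obtain ⟨L₁, hL₁, hL₁'⟩ := ih (update B i (B i \ C))
      obtain ⟨L₂, hL₂, hL₂'⟩ := ih (update B' j (B' j \ D))
      rw [← hB'j] at hD hD'
      have hfam₂ := (SparseFamily.box (H := H) hij (B := B) hCD).union hL₂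
        (piFinset_update_union hD) (disjoint_piFinset_update B' j D)
      have hfam := hfam₂.union hL₁ (piFinset_update_union hC) (disjoint_piFinset_update B i C)
      refine ⟨fun a b => ((if a = i ∧ b = j then Fintype.piFinset (update B' j D) else ∅)
        ∪ L₂ a b) ∪ L₁ a b, ?_, ?_⟩
      · convert hfam using 1
        rw [← pow_add, ← pow_add]
        congr 1
        have : 1 ≤ 2 ^ r := Nat.one_le_two_pow
        -- Palettes multiply: one factor `2 ^ |W|` for the sparse box and `2 ^ r - 1` for each
        -- remainder.
        rw [pow_succ, show 2 ^ r * 2 - 1 = 1 + (2 ^ r - 1) + (2 ^ r - 1) by omega]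
        ring
      · have hcard : ∀ a b, ((((if a = i ∧ b = j then Fintype.piFinset (update B' j D) else ∅)
            ∪ L₂ a b) ∪ L₁ a b).card : ℝ) =
            (if a = i ∧ b = j then ∏ l, ((update B' j D l).card : ℝ) else 0)
              + (L₂ a b).card + (L₁ a b).card := by
          intro a b
          rw [card_union_of_disjoint
            ((disjoint_piFinset_update B i C).mono (hfam₂.subset a b) (hL₁.subset a b)),
            card_union_of_disjoint]
          · push_cast
            congr 2
            split_ifs
            · rw [Fintype.card_piFinset]; push_cast; rfl
            · simp
          · refine (disjoint_piFinset_update B' j D).mono ?_ (hL₂.subset a b)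
            split_ifs
            · exact le_rfl
            · exact empty_subset _
        have hsum : ∑ a, ∑ b, (if a = i ∧ b = j then ∏ l, ((update B' j D l).card : ℝ) else 0)
            = ∏ l, ((update B' j D l).card : ℝ) := by
          rw [sum_eq_single i, sum_eq_single j] <;> simp +contextual
        have e1 := prod_card_update_add hC
        have e2 := prod_card_update_add hD
        have e3 : ((homsOn H E univ B').card : ℝ) +
            (homsOn H E univ (update B i (B i \ C))).card = (homsOn H E univ B).card := by
          exact_mod_cast card_homsOn_update_add hC
        have e4 : ((homsOn H E univ (update B' j D)).card : ℝ) +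
            (homsOn H E univ (update B' j (B' j \ D))).card = (homsOn H E univ B').card := by
          exact_mod_cast card_homsOn_update_add hD
        have e5 := prod_card_update_ge hC'
        have e6 := prod_card_update_ge hD'
        rw [← hB'] at e1 e5
        simp only [hcard, sum_add_distrib, hsum]
        set q := (1 - η ^ 2) ^ r with hq
        have hq0 : 0 ≤ q := pow_nonneg hρ _
        have e7 : η ^ 2 * ∏ l, ((B l).card : ℝ) ≤ ∏ l, ((update B' j D l).card : ℝ) := by
          calc _ = η * (η * ∏ l, ((B l).card : ℝ)) := by ring
            _ ≤ _ := (mul_le_mul_of_nonneg_left e5 hη0).trans e6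
        have e8 : ((homsOn H E univ (update B' j (B' j \ D))).card : ℝ) / κ +
            (homsOn H E univ (update B i (B i \ C))).card / κ
            ≤ (homsOn H E univ B).card / κ := by
          rw [← add_div]
          refine div_le_div_of_nonneg_right ?_ hκ0.le
          have : (0 : ℝ) ≤ (homsOn H E univ (update B' j D)).card := Nat.cast_nonneg _
          linarith
        have e9 : q * (∏ l, ((update B' j (B' j \ D) l).card : ℝ) +
            ∏ l, ((update B i (B i \ C) l).card : ℝ)) ≤
            (1 - η ^ 2) ^ (r + 1) * ∏ l, ((B l).card : ℝ) := by
          rw [pow_succ, ← hq, mul_assoc]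
          refine mul_le_mul_of_nonneg_left ?_ hq0
          linarith
        rw [mul_add] at e9
        linarith

/-- The slices of a subset of a box are on average as large as the subset. -/
lemma exists_large_slice {B : W → Finset V} {X : Finset (W → V)} (hX : X ⊆ Fintype.piFinset B)
    {i j : W} (hij : i ≠ j) (hB : (Fintype.piFinset B).Nonempty) :
    ∃ x ∈ Fintype.piFinset B, (X.card : ℝ) * ((B i).card * (B j).card) ≤
      (∏ l, ((B l).card : ℝ)) * (slice X x i j).card := by
  set T := (Fintype.piFinset B ×ˢ (univ : Finset (V × V))).filter
    fun p => replace p.1 i j p.2 ∈ X with hT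
  have hTcard : T.card = ∑ x ∈ Fintype.piFinset B, (slice X x i j).card := by
    rw [hT, card_filter, sum_product]
    exact sum_congr rfl fun x _ => by rw [slice, card_filter]
  have hle : (X ×ˢ (B i ×ˢ B j)).card ≤ T.card := by
    -- Swapping `q` with the coordinates of `y` at `i` and `j` loses no information, so this is a
    -- double count of the slices.
    refine card_le_card_of_injOn (fun p => (replace p.1 i j p.2, (p.1 i, p.1 j))) ?_ ?_
    · rintro ⟨y, q⟩ hp
      rw [mem_coe, mem_product, mem_product] at hp
      obtain ⟨hy, hq1, hq2⟩ := hp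
      rw [mem_coe, hT, mem_filter, mem_product]
      refine ⟨⟨?_, mem_univ _⟩, ?_⟩
      · rw [Fintype.mem_piFinset]
        intro l
        change replace y i j q l ∈ B l
        by_cases hj : l = j
        · subst hj; rw [replace_right]; exact hq2
        by_cases hi : l = i
        · subst hi; rw [replace_left hij]; exact hq1
        rw [replace_of_ne hi hj]
        exact Fintype.mem_piFinset.1 (hX hy) l
      · simpa only [replace_replace hij] using hy
    · rintro ⟨y, q⟩ _ ⟨y', q'⟩ _ h
      simp only [Prod.mk.injEq] at h
      obtain ⟨h1, h2, h3⟩ := h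
      have e1 : y = y' := by
        rw [← replace_replace (x := y) hij q, ← replace_replace (x := y') hij q', h1, h2, h3]
      have e2 : q.1 = q'.1 := by
        rw [← replace_left (x := y) hij q, h1, replace_left hij]
      have e3 : q.2 = q'.2 := by
        rw [← replace_right y i j q, h1, replace_right]
      exact Prod.ext e1 (Prod.ext e2 e3)
  rw [hTcard, card_product, card_product] at hle
  by_contra! hc
  have := sum_lt_sum_of_nonempty hB hc
  rw [← mul_sum, sum_const, nsmul_eq_mul, Fintype.card_piFinset, Nat.cast_prod] at this
  have hpos : (0 : ℝ) ≤ ∏ l, ((B l).card : ℝ) := prod_nonneg fun _ _ => Nat.cast_nonneg _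
  have hle' : (X.card : ℝ) * ((B i).card * (B j).card) ≤
    ∑ x ∈ Fintype.piFinset B, ((slice X x i j).card : ℝ) := by exact_mod_cast hle
  exact this.not_ge (mul_le_mul_of_nonneg_left hle' hpos)

/-- In a box with few homomorphisms, the parts belonging to some dart of `H` have a sparse subset of
large measure and bounded complexity. -/
lemma exists_sparse_region {H : SimpleGraph W} {E : Finset (V × V)}
    (hE : ∀ u v, (u, v) ∈ E → (v, u) ∈ E) {α η : ℝ} (hα0 : 0 < α) (hα1 : α ≤ 1)
    (hη0 : 0 ≤ η) (hη1 : η ≤ 1) (hη : 2 * Fintype.card W * η ≤ α ^ Fintype.card W)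
    {r : ℕ} (hr : (1 - η ^ 2) ^ r ≤ 1 / 8) {Δ : ℕ} (hΔ0 : 0 < Δ)
    (hΔ : ((univ : Finset (W × W)).filter fun p => H.Adj p.1 p.2).card = Δ)
    {B : W → Finset V} (hB0 : ∀ l, (B l).Nonempty)
    (hB : ((homsOn H E univ B).card : ℝ) ≤
      (α ^ Fintype.card W / 2) ^ Fintype.card W / 8 * ∏ l, ((B l).card : ℝ)) :
    ∃ i j, H.Adj i j ∧ ∃ S ⊆ B i ×ˢ B j,
      3 / (4 * Δ) * ((B i).card * (B j).card : ℝ) ≤ S.card ∧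
      ((E ∩ S).card : ℝ) ≤ α * S.card ∧
      ∃ c : V → Fin (2 ^ (Fintype.card W * (2 ^ r - 1))), ∀ u v u' v', c u = c u' → c v = c v' →
        ((u, v) ∈ S ↔ (u', v') ∈ S) := by
  set κ := (α ^ Fintype.card W / 2) ^ Fintype.card W with hκ
  have hκ0 : 0 < κ := by rw [hκ]; positivity
  obtain ⟨L, hL, hcov⟩ := exists_sparseFamily hE hα0 hα1 hη0 hη1 hη hκ r B
  set vol := ∏ l, ((B l).card : ℝ) with hvol
  have hvol0 : 0 < vol := by
    rw [hvol]; exact prod_pos fun l _ => by exact_mod_cast (hB0 l).card_pos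
  set D := (univ : Finset (W × W)).filter fun p => H.Adj p.1 p.2 with hD
  have hsum : ∑ i, ∑ j, ((L i j).card : ℝ) = ∑ p ∈ D, ((L p.1 p.2).card : ℝ) := by
    rw [← sum_product', hD, sum_filter, univ_product_univ]
    refine sum_congr rfl fun p _ => ?_
    split_ifs with h
    · rfl
    · rw [hL.eq_empty _ _ h]; simp
  have hΔ0' : (0 : ℝ) < Δ := by exact_mod_cast hΔ0
  -- An eighth of the volume is lost to the uncovered remainder, another to boxes rich in
  -- homomorphisms.
  have h34 : 3 / 4 * vol ≤ ∑ p ∈ D, ((L p.1 p.2).card : ℝ) := by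
    rw [← hsum]
    have h1 : ((homsOn H E univ B).card : ℝ) / κ ≤ vol / 8 := by
      rw [div_le_iff₀ hκ0]; linarith
    have h2 : (1 - η ^ 2) ^ r * vol ≤ 1 / 8 * vol := mul_le_mul_of_nonneg_right hr hvol0.le
    linarith
  have hDne : D.Nonempty := card_pos.1 (hΔ ▸ hΔ0)
  obtain ⟨⟨i, j⟩, hp, hLp⟩ : ∃ p ∈ D, 3 / (4 * Δ) * vol ≤ ((L p.1 p.2).card : ℝ) := by
    refine exists_le_of_sum_le hDne ?_
    rw [sum_const, hΔ, nsmul_eq_mul]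
    refine le_trans (le_of_eq ?_) h34
    field_simp
  have hij : H.Adj i j := (mem_filter.1 hp).2
  obtain ⟨x, hx, hxs⟩ := exists_large_slice (hL.subset i j) hij.ne
    (Fintype.piFinset_nonempty.2 hB0)
  refine ⟨i, j, hij, slice (L i j) x i j, ?_, ?_, hL.sparse i j x, ?_⟩
  · intro p hp
    have := Fintype.mem_piFinset.1 (hL.subset i j (mem_slice.1 hp))
    have h1 := this i
    have h2 := this j
    rw [replace_left hij.ne] at h1
    rw [replace_right] at h2
    exact mem_product.2 ⟨h1, h2⟩
  · refine le_of_mul_le_mul_left (le_trans ?_ hxs) hvol0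
    calc vol * (3 / (4 * Δ) * ((B i).card * (B j).card : ℝ))
        = 3 / (4 * Δ) * vol * ((B i).card * (B j).card : ℝ) := by ring
      _ ≤ _ := mul_le_mul_of_nonneg_right hLp
          (mul_nonneg (Nat.cast_nonneg _) (Nat.cast_nonneg _))
  · obtain ⟨c, hc⟩ := hL.coloring
    refine ⟨c, fun u v u' v' hu hv => ?_⟩
    rw [mem_slice, mem_slice]
    refine hc i j _ _ fun l => ?_
    by_cases hj : l = j
    · subst hj; rw [replace_right, replace_right]; exact hv
    by_cases hi : l = i
    · subst hi; rw [replace_left hij.ne, replace_left hij.ne]; exact hu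
    rw [replace_of_ne hi hj, replace_of_ne hi hj]

end

/-! ### The sum of log-densities and its gain under refinement -/

section
open scoped Classical
open Finset

variable {X κ κ' : Type*} [Fintype X]

/-- The density of `E` on the cell of `x` in the partition of `X` into the fibres of `p`. -/
noncomputable def cellDensity (p : X → κ) (E : Finset X) (x : X) : ℝ :=
  (E.filter fun y => p y = p x).card / ((univ : Finset X).filter fun y => p y = p x).card

/-- The sum over `E` of the logarithms of the cell densities. -/
noncomputable def logSum (p : X → κ) (E : Finset X) : ℝ :=
  ∑ x ∈ E, Real.log (cellDensity p E x)

lemma cellDensity_nonneg (p : X → κ) (E : Finset X) (x : X) : 0 ≤ cellDensity p E x := by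
  unfold cellDensity; positivity

lemma cellDensity_le_one (p : X → κ) (E : Finset X) (x : X) : cellDensity p E x ≤ 1 := by
  refine div_le_one_of_le₀ ?_ (by positivity)
  exact_mod_cast card_le_card (filter_subset_filter _ (subset_univ _))

lemma card_cell_pos (p : X → κ) (x : X) :
    0 < ((univ : Finset X).filter fun y => p y = p x).card :=
  card_pos.2 ⟨x, by simp⟩

lemma cellDensity_pos (p : X → κ) {E : Finset X} {x : X} (hx : x ∈ E) :
    0 < cellDensity p E x := by
  refine div_pos ?_ (by exact_mod_cast card_cell_pos p x)
  exact_mod_cast card_pos.2 ⟨x, by simpa using hx⟩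

lemma cellDensity_congr {p : X → κ} (E : Finset X) {x y : X} (h : p x = p y) :
    cellDensity p E x = cellDensity p E y := by
  unfold cellDensity; rw [h]

lemma logSum_nonpos (p : X → κ) (E : Finset X) : logSum p E ≤ 0 :=
  sum_nonpos fun x _ => Real.log_nonpos (cellDensity_nonneg p E x) (cellDensity_le_one p E x)

/-- Replacing the indicator of `E` by its cell averages does not change sums of functions which are
constant on cells. -/
lemma sum_eq_sum_cellDensity_mul {p : X → κ} (E : Finset X) {φ : X → ℝ}
    (hφ : ∀ x y, p x = p y → φ x = φ y) : ∑ x ∈ E, φ x = ∑ x, cellDensity p E x * φ x := by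
  have h1 : ∀ x, cellDensity p E x * φ x = ∑ y ∈ E, if p y = p x then
      φ y / ((univ : Finset X).filter fun z => p z = p y).card else 0 := by
    intro x
    rw [← sum_filter, sum_congr rfl (g := fun _ =>
      φ x / ((univ : Finset X).filter fun z => p z = p x).card)]
    · rw [sum_const, nsmul_eq_mul, cellDensity]; ring
    · intro y hy
      have hy := (mem_filter.1 hy).2
      rw [hφ y x hy, hy]
  simp_rw [h1]
  rw [sum_comm]
  refine sum_congr rfl fun y _ => ?_
  rw [← sum_filter, sum_const, nsmul_eq_mul]
  have h2 : (univ.filter fun x => p y = p x) = univ.filter fun x => p x = p y :=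
    filter_congr fun x _ => eq_comm
  rw [h2]
  have := card_cell_pos p y
  field_simp

lemma sum_cellDensity (p : X → κ) (E : Finset X) : ∑ x, cellDensity p E x = E.card := by
  have := sum_eq_sum_cellDensity_mul (p := p) E (φ := fun _ => 1) fun _ _ _ => rfl
  simpa using this.symm

/-- Refining a partition increases the sum of logarithms in terms of a set which is a union of new
cells and on which the density drops. -/
lemma logSum_refine [DecidableEq X] {p : X → κ} {q : X → κ'} (E : Finset X)
    (hqp : ∀ x y, q x = q y → p x = p y) {Z : Finset X}
    (hZ : ∀ x y, q x = q y → (x ∈ Z ↔ y ∈ Z)) :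
    logSum p E + (3 / 4 * ∑ x ∈ Z, cellDensity p E x - 2 * (E ∩ Z).card) ≤ logSum q E := by
  -- Trial weights: `log t ≤ t - 1` is applied to `t = d_p w / d_q` and summed over `E`. The weight
  -- saves `3/4` of the mass of `d_p` on `Z` and costs `-log (1/4) ≤ 2` per element of `E ∩ Z`.
  set w : X → ℝ := fun x => if x ∈ Z then 1 / 4 else 1 with hw
  have hw0 : ∀ x, 0 < w x := fun x => by simp only [hw]; split_ifs <;> norm_num
  have h1 : ∀ x ∈ E, Real.log (cellDensity p E x) + Real.log (w x) -
      Real.log (cellDensity q E x) ≤ cellDensity p E x * w x / cellDensity q E x - 1 := by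
    intro x hx
    have hp := cellDensity_pos p hx
    have hq := cellDensity_pos q hx
    rw [← Real.log_mul hp.ne' (hw0 x).ne', ← Real.log_div (mul_pos hp (hw0 x)).ne' hq.ne']
    exact Real.log_le_sub_one_of_pos (div_pos (mul_pos hp (hw0 x)) hq)
  -- The summand is constant on cells of `q`, so averaging cancels `d_q`. Cells missing `E`, where
  -- division by zero gives zero, make it an inequality.
  have h2 : ∑ x ∈ E, cellDensity p E x * w x / cellDensity q E x ≤
      ∑ x, cellDensity p E x * w x := by
    rw [sum_eq_sum_cellDensity_mul (p := q)]
    · refine sum_le_sum fun x _ => ?_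
      rcases (cellDensity_nonneg q E x).eq_or_lt with h | h
      · rw [← h, zero_mul]; exact mul_nonneg (cellDensity_nonneg p E x) (hw0 x).le
      · rw [mul_div_cancel₀ _ h.ne']
    · intro x y hxy
      rw [cellDensity_congr E (hqp x y hxy), cellDensity_congr E hxy]
      simp only [hw, hZ x y hxy]
  have h3 : ∑ x, cellDensity p E x * w x =
      E.card - 3 / 4 * ∑ x ∈ Z, cellDensity p E x := by
    rw [← sum_cellDensity p E, mul_sum, show Z = univ.filter (· ∈ Z) by simp, sum_filter,
      ← sum_sub_distrib]
    refine sum_congr rfl fun x _ => ?_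
    simp only [hw]
    split_ifs <;> ring
  have h4 : ∑ x ∈ E, Real.log (w x) ≥ - (2 * (E ∩ Z).card) := by
    have hlog : Real.log (1 / 4) ≥ -2 := by
      rw [show (1 / 4 : ℝ) = (2 ^ 2)⁻¹ by norm_num, Real.log_inv, Real.log_pow]
      have := Real.log_two_lt_d9
      push_cast; linarith
    have : ∑ x ∈ E, Real.log (w x) = (E ∩ Z).card * Real.log (1 / 4) := by
      rw [← filter_mem_eq_inter, ← nsmul_eq_mul, ← sum_const, sum_filter]
      refine sum_congr rfl fun x _ => ?_
      simp only [hw]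
      split_ifs <;> simp
    rw [this]
    nlinarith [Nat.cast_nonneg (α := ℝ) (E ∩ Z).card]
  have h5 := sum_le_sum h1
  simp only [sum_sub_distrib, sum_add_distrib, sum_const, nsmul_eq_mul, mul_one] at h5
  unfold logSum
  linarith

end

/-! ### One refinement step -/

section
open scoped Classical
open Finset

variable {V W ι : Type*} [Fintype V] [Fintype W] [Fintype ι]

/-- The fibre of `P` over `a`. -/
noncomputable def part (P : V → ι) (a : ι) : Finset V := univ.filter fun v => P v = a

/-- The elements of `E` between the parts `a` and `b`. -/
noncomputable def between (P : V → ι) (E : Finset (V × V)) (a b : ι) : Finset (V × V) :=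
  E.filter fun p => (P p.1, P p.2) = (a, b)

/-- The partition of pairs of vertices induced by a partition of the vertices. -/
def pairMap (P : V → ι) (p : V × V) : ι × ι := (P p.1, P p.2)

lemma mem_part {P : V → ι} {a : ι} {v : V} : v ∈ part P a ↔ P v = a := by simp [part]

lemma mem_between {P : V → ι} {E : Finset (V × V)} {a b : ι} {p : V × V} :
    p ∈ between P E a b ↔ p ∈ E ∧ P p.1 = a ∧ P p.2 = b := by simp [between]

lemma between_subset (P : V → ι) (E : Finset (V × V)) (a b : ι) :
    between P E a b ⊆ part P a ×ˢ part P b := by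
  intro p hp
  have := (mem_filter.1 hp).2
  rw [Prod.mk.injEq] at this
  rw [mem_product, mem_part, mem_part]
  exact this

lemma sum_card_part (P : V → ι) : ∑ a, ((part P a).card : ℝ) = Fintype.card V := by
  have := card_eq_sum_card_fiberwise (s := (univ : Finset V)) (t := univ) (f := P)
    (fun _ _ => by simp)
  rw [← card_univ, this, Nat.cast_sum]
  rfl

lemma cellDensity_pairMap (P : V → ι) (E : Finset (V × V)) (p : V × V) :
    cellDensity (pairMap P) E p = (between P E (P p.1) (P p.2)).card /
      ((part P (P p.1)).card * (part P (P p.2)).card : ℝ) := by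
  unfold cellDensity
  congr 1
  · refine congrArg (Nat.cast (R := ℝ)) (congrArg card ?_)
    ext q
    simp [between, pairMap]
  · rw [← Nat.cast_mul, ← card_product]
    refine congrArg (Nat.cast (R := ℝ)) (congrArg card ?_)
    ext q
    simp [pairMap, mem_part]

lemma card_filter_pairs_eq_sum (P : V → ι) (E : Finset (V × V)) (R : ι → ι → Prop) :
    ((E.filter fun p => R (P p.1) (P p.2)).card : ℝ) =
      ∑ q : ι × ι, if R q.1 q.2 then ((between P E q.1 q.2).card : ℝ) else 0 := by
  rw [card_eq_sum_card_fiberwise (s := E.filter fun p => R (P p.1) (P p.2)) (t := univ)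
    (f := fun p => (P p.1, P p.2)) (fun _ _ => by simp), Nat.cast_sum]
  refine sum_congr rfl fun q _ => ?_
  rw [filter_filter]
  split_ifs with h
  · congr 2
    refine filter_congr fun p _ => ⟨fun hp => hp.2, fun hp => ⟨?_, hp⟩⟩
    have h1 : P p.1 = q.1 := congrArg Prod.fst hp
    have h2 : P p.2 = q.2 := congrArg Prod.snd hp
    rw [h1, h2]; exact h
  · rw [filter_eq_empty_iff.2]
    · simp
    · rintro p _ ⟨h1, rfl⟩
      exact h h1

/-- The pairs of parts with too few elements of `E` for their size or in absolute terms. -/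
def Light (P : V → ι) (E : Finset (V × V)) (σ : ℝ) (T : ℕ) (a b : ι) : Prop :=
  ((between P E a b).card : ℝ) <
    σ * ((part P a).card * (part P b).card + (Fintype.card V / T : ℝ) ^ 2)

/-- Each of the two terms in `Light` contributes at most `σ n²` when summed over all pairs of parts.
-/
lemma card_light_le (P : V → ι) (E : Finset (V × V)) {σ : ℝ} (hσ : 0 ≤ σ) {T : ℕ}
    (hT : Fintype.card ι ≤ T) :
    ((E.filter fun p => Light P E σ T (P p.1) (P p.2)).card : ℝ)
      ≤ 2 * σ * (Fintype.card V : ℝ) ^ 2 := by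
  rw [card_filter_pairs_eq_sum]
  calc _ ≤ ∑ q : ι × ι,
        σ * ((part P q.1).card * (part P q.2).card + (Fintype.card V / T : ℝ) ^ 2) := by
        refine sum_le_sum fun q _ => ?_
        split_ifs with h
        · exact h.le
        · positivity
    _ = σ * ((∑ a, ((part P a).card : ℝ)) * (∑ b, ((part P b).card : ℝ)) +
          (Fintype.card ι : ℝ) ^ 2 * (Fintype.card V / T : ℝ) ^ 2) := by
        rw [← mul_sum, sum_add_distrib, sum_mul_sum, ← sum_product', sum_const, nsmul_eq_mul,
          card_univ, Fintype.card_prod, univ_product_univ]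
        push_cast; ring
    _ ≤ σ * ((Fintype.card V : ℝ) ^ 2 + (Fintype.card V : ℝ) ^ 2) := by
        refine mul_le_mul_of_nonneg_left ?_ hσ
        rw [sum_card_part, ← mul_pow, ← sq]
        gcongr
        rw [mul_div_assoc']
        refine div_le_of_le_mul₀ (by positivity) (by positivity) ?_
        rw [mul_comm]
        gcongr
    _ = _ := by ring

/-- The pair of parts `a`, `b` has density well above `α`, and contains a large sparse subset
determined by a colouring with `k` colours. -/
def Shattered (P : V → ι) (E : Finset (V × V)) (α θ : ℝ) (k : ℕ) (a b : ι)
    (S : Finset (V × V)) (c : V → Fin k) : Prop :=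
  8 * α * ((part P a).card * (part P b).card) ≤ ((between P E a b).card : ℝ) ∧
  S ⊆ part P a ×ˢ part P b ∧
  θ * ((part P a).card * (part P b).card : ℝ) ≤ S.card ∧
  ((E ∩ S).card : ℝ) ≤ α * S.card ∧
  ∀ u v u' v', c u = c u' → c v = c v' → ((u, v) ∈ S ↔ (u', v') ∈ S)

/-- The pair of parts `a`, `b` is shattered by some subset and some colouring. -/
def IsShattered (P : V → ι) (E : Finset (V × V)) (α θ : ℝ) (k : ℕ) (a b : ι) : Prop :=
  ∃ S c, Shattered P E α θ k a b S c

/-- If `D ≥ 8α` is the cell density, the cost `2 |E ∩ S| ≤ 2α |S|` is at most `D |S| / 4`, which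
leaves `D |S| / 2`. -/
lemma Shattered.gain {P : V → ι} {E : Finset (V × V)} {α θ : ℝ} {k : ℕ} {a b : ι}
    {S : Finset (V × V)} {c : V → Fin k} (h : Shattered P E α θ k a b S c) :
    θ / 2 * (between P E a b).card ≤
      3 / 4 * ∑ x ∈ S, cellDensity (pairMap P) E x - 2 * (E ∩ S).card := by
  obtain ⟨h1, h2, h3, h4, -⟩ := h
  set m : ℝ := (part P a).card * (part P b).card with hm
  set e : ℝ := ((between P E a b).card : ℝ) with he
  have hsum : ∑ x ∈ S, cellDensity (pairMap P) E x = S.card * (e / m) := by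
    rw [← nsmul_eq_mul, ← sum_const]
    refine sum_congr rfl fun x hx => ?_
    have := mem_product.1 (h2 hx)
    rw [mem_part, mem_part] at this
    rw [cellDensity_pairMap, this.1, this.2]
  have hem : e ≤ m := by
    rw [hm, he, ← Nat.cast_mul, ← card_product]
    exact_mod_cast card_le_card (between_subset P E a b)
  have he0 : 0 ≤ e := Nat.cast_nonneg _
  have hS0 : (0 : ℝ) ≤ S.card := Nat.cast_nonneg _
  rw [hsum]
  have hm0 : 0 ≤ m := he0.trans hem
  rcases hm0.eq_or_lt with h0 | h0
  · have hS : S.card = 0 := by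
      have : (S.card : ℝ) ≤ m := by
        rw [hm, ← Nat.cast_mul, ← card_product]
        exact_mod_cast card_le_card h2
      rw [← h0] at this
      exact_mod_cast le_antisymm this hS0
    have he' : e = 0 := le_antisymm (h0 ▸ hem) he0
    rw [card_eq_zero.1 hS, he']; simp
  · set D := e / m with hD
    have h5 : 8 * α ≤ D := by rw [hD, le_div_iff₀ h0]; exact h1
    have h6 : e = D * m := by rw [hD, div_mul_cancel₀ _ h0.ne']
    have hD0 : 0 ≤ D := div_nonneg he0 hm0
    have h7 : D * (θ * m) ≤ D * S.card := mul_le_mul_of_nonneg_left h3 hD0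
    have h8 : 8 * α * S.card ≤ D * S.card := mul_le_mul_of_nonneg_right h5 hS0
    rw [h6]
    linarith

/-- A family of maps from `H` to `E` such that distinct members use disjoint sets of pairs. -/
structure IsPacking (H : SimpleGraph W) (E : Finset (V × V)) (F : Finset (W → V)) : Prop where
  mem : ∀ x ∈ F, ∀ i j, H.Adj i j → (x i, x j) ∈ E
  disjoint : ∀ x ∈ F, ∀ y ∈ F, ∀ i j k l, H.Adj i j → H.Adj k l →
    (x i, x j) = (y k, y l) → x = y

/-- Choosing in each copy a pair satisfying `R` is injective, since distinct copies share no pair.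
-/
lemma IsPacking.card_le {H : SimpleGraph W} {E : Finset (V × V)} {F F' : Finset (W → V)}
    (hF : IsPacking H E F) (hF' : F' ⊆ F) (R : V × V → Prop)
    (h : ∀ x ∈ F', ∃ i j, H.Adj i j ∧ R (x i, x j)) :
    F'.card ≤ (E.filter R).card := by
  choose i j hij hR using h
  rw [← card_attach]
  refine card_le_card_of_injOn
    (fun x => ((x : W → V) (i x x.2), (x : W → V) (j x x.2))) ?_ ?_
  · intro x _
    exact mem_coe.2 (mem_filter.2 ⟨hF.mem x (hF' x.2) _ _ (hij x x.2), hR x x.2⟩)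
  · intro x _ y _ hxy
    exact Subtype.ext (hF.disjoint x (hF' x.2) y (hF' y.2) _ _ _ _ (hij x x.2) (hij y y.2) hxy)

/-- A member of the packing none of whose pairs is light has a pair in a shattered cell. -/
lemma exists_shattered {H : SimpleGraph W} {E : Finset (V × V)}
    (hE : ∀ u v, (u, v) ∈ E → (v, u) ∈ E) {α η σ : ℝ} (hα0 : 0 < α) (hα1 : α ≤ 1)
    (hη0 : 0 ≤ η) (hη1 : η ≤ 1) (hη : 2 * Fintype.card W * η ≤ α ^ Fintype.card W)
    (hασ : 8 * α ≤ σ) (hσ1 : σ ≤ 1)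
    {r : ℕ} (hr : (1 - η ^ 2) ^ r ≤ 1 / 8) {Δ : ℕ} (hΔ0 : 0 < Δ)
    (hΔ : ((univ : Finset (W × W)).filter fun p => H.Adj p.1 p.2).card = Δ)
    (P : V → ι) {T : ℕ} (hT : 0 < T)
    (hhom : ((homsOn H E univ fun _ => univ).card : ℝ) ≤
      (α ^ Fintype.card W / 2) ^ Fintype.card W / 8 *
        (σ / T ^ 2 * Fintype.card V) ^ Fintype.card W)
    {x : W → V} (hx : ∀ i j, H.Adj i j → ¬ Light P E σ T (P (x i)) (P (x j))) :
    ∃ i j, H.Adj i j ∧ IsShattered P E α (3 / (4 * Δ))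
      (2 ^ (Fintype.card W * (2 ^ r - 1))) (P (x i)) (P (x j)) := by
  have hσ0 : 0 < σ := by linarith
  -- Isolated vertices of `H` get the whole vertex set, as no pair bounds their parts from below.
  set B : W → Finset V := fun l => if ∃ j, H.Adj l j then part P (P (x l)) else univ with hBdef
  have hxB : ∀ l, x l ∈ B l := by
    intro l
    simp only [hBdef]
    split_ifs
    · exact mem_part.2 rfl
    · exact mem_univ _
  have hpart : ∀ i j, H.Adj i j → B i = part P (P (x i)) := fun i j hij => if_pos ⟨j, hij⟩
  have hdense : ∀ i j, H.Adj i j →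
      σ * ((part P (P (x i))).card * (part P (P (x j))).card + (Fintype.card V / T : ℝ) ^ 2) ≤
        (between P E (P (x i)) (P (x j))).card := fun i j hij => not_lt.1 (hx i j hij)
  have hT0 : (0 : ℝ) < T := by exact_mod_cast hT
  -- A pair that is not light has at least `σ (n / T) ^ 2` elements of `E`, but at most `n` times
  -- the size of either part.
  have hcard : ∀ l, σ / T ^ 2 * Fintype.card V ≤ ((B l).card : ℝ) := by
    intro l
    have hn : (0 : ℝ) < Fintype.card V := by exact_mod_cast Fintype.card_pos_iff.2 ⟨x l⟩
    by_cases hl : ∃ j, H.Adj l j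
    · obtain ⟨j, hj⟩ := hl
      rw [hpart l j hj]
      have h1 := hdense l j hj
      have h2 : ((between P E (P (x l)) (P (x j))).card : ℝ) ≤
          (part P (P (x l))).card * Fintype.card V := by
        have h3 := card_le_card (between_subset P E (P (x l)) (P (x j)))
        rw [card_product] at h3
        exact_mod_cast h3.trans (Nat.mul_le_mul_left _ (card_le_univ _))
      have h4 : 0 ≤ σ * (((part P (P (x l))).card : ℝ) * (part P (P (x j))).card) :=
        mul_nonneg hσ0.le (mul_nonneg (Nat.cast_nonneg _) (Nat.cast_nonneg _))
      refine le_of_mul_le_mul_right ?_ hn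
      have h5 : σ / (T : ℝ) ^ 2 * Fintype.card V * Fintype.card V =
        σ * (Fintype.card V / T : ℝ) ^ 2 := by field_simp
      rw [h5]
      linarith
    · simp only [hBdef, if_neg hl, card_univ]
      refine mul_le_of_le_one_left hn.le ?_
      refine div_le_one_of_le₀ ?_ (by positivity)
      have : (1 : ℝ) ≤ T ^ 2 := one_le_pow₀ (by exact_mod_cast hT)
      linarith
  have hhomB : ((homsOn H E univ B).card : ℝ) ≤
      (α ^ Fintype.card W / 2) ^ Fintype.card W / 8 * ∏ l, ((B l).card : ℝ) := by
    have h1 : ((homsOn H E univ B).card : ℝ) ≤ (homsOn H E univ fun _ => univ).card := by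
      refine Nat.cast_le.2 (card_le_card fun y hy => ?_)
      rw [mem_homsOn] at hy ⊢
      exact ⟨fun _ => mem_univ _, hy.2⟩
    refine h1.trans (hhom.trans (mul_le_mul_of_nonneg_left ?_ ?_))
    · rw [← card_univ (α := W), ← prod_const]
      exact prod_le_prod (fun _ _ => mul_nonneg (div_nonneg hσ0.le (sq_nonneg _))
        (Nat.cast_nonneg _)) fun l _ => hcard l
    · exact div_nonneg (pow_nonneg (div_nonneg (pow_nonneg hα0.le _) (by norm_num)) _)
        (by norm_num)
  obtain ⟨i, j, hij, S, hS, hS1, hS2, c, hc⟩ := exists_sparse_region hE hα0 hα1 hη0 hη1 hη hr hΔ0 hΔ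
    (fun l => ⟨x l, hxB l⟩) hhomB
  rw [hpart i j hij, hpart j i hij.symm] at hS hS1
  refine ⟨i, j, hij, S, c, ?_, hS, hS1, hS2, hc⟩
  refine le_trans ?_ (hdense i j hij)
  refine (mul_le_mul_of_nonneg_right hασ (mul_nonneg (Nat.cast_nonneg _)
    (Nat.cast_nonneg _))).trans (mul_le_mul_of_nonneg_left ?_ hσ0.le)
  exact le_add_of_nonneg_right (sq_nonneg _)

/-- A simultaneous refinement along shattered cells increases the sum of logarithms. -/
lemma exists_refinement_of_shattered (P : V → ι) (E : Finset (V × V)) {α θ : ℝ} {k : ℕ}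
    (hk : 0 < k) :
    ∃ Q : V → ι × (ι → Fin k × Fin k), logSum (pairMap P) E + θ / 2 *
      (E.filter fun p => IsShattered P E α θ k (P p.1) (P p.2)).card ≤
        logSum (pairMap Q) E := by
  have hex : ∀ a b, ∃ S : Finset (V × V), ∃ c : V → Fin k,
      ((IsShattered P E α θ k a b) → Shattered P E α θ k a b S c) ∧
      ((¬ IsShattered P E α θ k a b) → S = ∅) := by
    intro a b
    by_cases h : IsShattered P E α θ k a b
    · obtain ⟨S, c, hS⟩ := h
      exact ⟨S, c, fun _ => hS, fun h' => absurd ⟨S, c, hS⟩ h'⟩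
    · exact ⟨∅, fun _ => ⟨0, hk⟩, fun h' => absurd h' h, fun _ => rfl⟩
  choose S c hS hS0 using hex
  have hsub : ∀ a b, S a b ⊆ part P a ×ˢ part P b := by
    intro a b
    by_cases h : IsShattered P E α θ k a b
    · exact (hS a b h).2.1
    · rw [hS0 a b h]; exact empty_subset _
  -- For every part `b`, a vertex records its colour as first coordinate in the cell `(P v, b)` and
  -- as second coordinate in `(b, P v)`. All the sets `S a b` become unions of new cells at once.
  set Q : V → ι × (ι → Fin k × Fin k) :=
    fun v => (P v, fun b => (c (P v) b v, c b (P v) v)) with hQ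
  set Z : Finset (V × V) := univ.filter fun p => p ∈ S (P p.1) (P p.2) with hZ
  have hfib : ∀ q : ι × ι, (Z.filter fun p => (P p.1, P p.2) = q) = S q.1 q.2 := by
    rintro ⟨a, b⟩
    ext p
    rw [mem_filter, hZ, mem_filter]
    constructor
    · rintro ⟨⟨-, hp⟩, h⟩
      rw [Prod.mk.injEq] at h
      rwa [h.1, h.2] at hp
    · intro hp
      have := mem_product.1 (hsub a b hp)
      rw [mem_part, mem_part] at this
      rw [this.1, this.2]
      exact ⟨⟨mem_univ _, hp⟩, rfl⟩
  refine ⟨Q, ?_⟩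
  refine le_trans ?_ (logSum_refine (p := pairMap P) (q := pairMap Q) (Z := Z) E ?_ ?_)
  · refine add_le_add_right ?_ _
    have e1 : ∑ x ∈ Z, cellDensity (pairMap P) E x =
        ∑ q : ι × ι, ∑ x ∈ S q.1 q.2, cellDensity (pairMap P) E x := by
      rw [← sum_fiberwise Z (fun p => (P p.1, P p.2))]
      exact sum_congr rfl fun q _ => by rw [hfib]
    have e2 : ((E ∩ Z).card : ℝ) = ∑ q : ι × ι, ((E ∩ S q.1 q.2).card : ℝ) := by
      rw [card_eq_sum_card_fiberwise (s := E ∩ Z) (t := univ)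
        (f := fun p => (P p.1, P p.2)) (fun _ _ => by simp), Nat.cast_sum]
      refine sum_congr rfl fun q _ => ?_
      congr 2
      rw [← hfib q]
      ext p
      simp only [mem_filter, mem_inter, and_assoc]
    rw [card_filter_pairs_eq_sum P E (IsShattered P E α θ k), e1, e2,
      mul_sum, mul_sum, mul_sum, ← sum_sub_distrib]
    refine sum_le_sum fun q _ => ?_
    split_ifs with h
    · exact (hS q.1 q.2 h).gain
    · rw [hS0 q.1 q.2 h]; simp
  · rintro ⟨u, v⟩ ⟨u', v'⟩ h
    simp only [pairMap, hQ, Prod.mk.injEq] at h ⊢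
    exact ⟨h.1.1, h.2.1⟩
  · rintro ⟨u, v⟩ ⟨u', v'⟩ h
    simp only [pairMap, hQ, Prod.mk.injEq] at h
    obtain ⟨⟨h1, h2⟩, h3, h4⟩ := h
    rw [hZ, mem_filter, mem_filter]
    simp only [mem_univ, true_and]
    rw [← h1, ← h3]
    by_cases hs : IsShattered P E α θ k (P u) (P v)
    · refine (hS _ _ hs).2.2.2.2 u v u' v' ?_ ?_
      · have := (Prod.ext_iff.1 (congrFun h2 (P v))).1
        rw [← h1] at this
        exact this
      · have := (Prod.ext_iff.1 (congrFun h4 (P u))).2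
        rw [← h3] at this
        exact this
    · rw [hS0 _ _ hs]; simp

/-- One step of the iteration: if `E` has few homomorphisms from `H`, every partition has a
refinement with a larger sum of logarithms. -/
lemma exists_refinement {H : SimpleGraph W} {E : Finset (V × V)}
    (hE : ∀ u v, (u, v) ∈ E → (v, u) ∈ E) {F : Finset (W → V)} (hF : IsPacking H E F)
    {α η : ℝ} (hα0 : 0 < α) (hα1 : α ≤ 1)
    (hη0 : 0 ≤ η) (hη1 : η ≤ 1) (hη : 2 * Fintype.card W * η ≤ α ^ Fintype.card W)
    (hασ : 8 * α ≤ F.card / (8 * Fintype.card V ^ 2))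
    {r : ℕ} (hr : (1 - η ^ 2) ^ r ≤ 1 / 8) {Δ : ℕ} (hΔ0 : 0 < Δ)
    (hΔ : ((univ : Finset (W × W)).filter fun p => H.Adj p.1 p.2).card = Δ)
    {T T' : ℕ} (hT : 0 < T)
    (hhom : ((homsOn H E univ fun _ => univ).card : ℝ) ≤
      (α ^ Fintype.card W / 2) ^ Fintype.card W / 8 *
        (8 * α / T ^ 2 * Fintype.card V) ^ Fintype.card W)
    (hT' : T * (2 ^ (2 * Fintype.card W * 2 ^ r)) ^ T ≤ T') (P : V → Fin T) :
    ∃ Q : V → Fin T', logSum (pairMap P) E + F.card / (4 * Δ) ≤ logSum (pairMap Q) E := by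
  -- With this `σ`, the bound `2 σ n²` on light elements equals `|F| / 4`.
  set σ : ℝ := F.card / (8 * Fintype.card V ^ 2) with hσ
  set k := 2 ^ (Fintype.card W * (2 ^ r - 1)) with hk
  have hk0 : 0 < k := by rw [hk]; positivity
  have hσ0 : 0 < σ := by linarith
  have hn2 : (0 : ℝ) < Fintype.card V ^ 2 := by
    rcases Nat.eq_zero_or_pos (Fintype.card V) with h | h
    · rw [hσ, h] at hσ0; simp at hσ0
    · have : (0 : ℝ) < Fintype.card V := by exact_mod_cast h
      exact pow_pos this 2
  obtain ⟨⟨i₀, j₀⟩, hd₀⟩ := card_pos.1 (hΔ ▸ hΔ0)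
  have hij₀ : H.Adj i₀ j₀ := (mem_filter.1 hd₀).2
  have hFn : (F.card : ℝ) ≤ Fintype.card V ^ 2 := by
    have h1 := hF.card_le subset_rfl (fun _ => True) fun x _ => ⟨i₀, j₀, hij₀, trivial⟩
    have h2 : (E.filter fun _ => True).card ≤ Fintype.card (V × V) := card_le_univ _
    rw [Fintype.card_prod, ← sq] at h2
    have h3 : F.card ≤ Fintype.card V ^ 2 := h1.trans (le_of_eq_of_le (by congr) h2)
    exact_mod_cast h3
  have hσ1 : σ ≤ 1 := by
    rw [hσ]
    refine div_le_one_of_le₀ ?_ (by positivity)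
    linarith
  have hσn : 2 * σ * (Fintype.card V : ℝ) ^ 2 = F.card / 4 := by
    have : (F.card : ℝ) = σ * (8 * Fintype.card V ^ 2) := by
      rw [hσ, div_mul_cancel₀]; exact (mul_pos (by norm_num) hn2).ne'
    rw [this]; ring
  have hhom' : ((homsOn H E univ fun _ => univ).card : ℝ) ≤
      (α ^ Fintype.card W / 2) ^ Fintype.card W / 8 *
        (σ / T ^ 2 * Fintype.card V) ^ Fintype.card W := by
    refine hhom.trans (mul_le_mul_of_nonneg_left ?_ ?_)
    · refine pow_le_pow_left₀ (mul_nonneg (div_nonneg (by linarith) (sq_nonneg _))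
        (Nat.cast_nonneg _)) ?_ _
      exact mul_le_mul_of_nonneg_right (div_le_div_of_nonneg_right hασ (sq_nonneg _))
        (Nat.cast_nonneg _)
    · exact div_nonneg (pow_nonneg (div_nonneg (pow_nonneg hα0.le _) (by norm_num)) _)
        (by norm_num)
  set FL := F.filter fun x => ∃ i j, H.Adj i j ∧ Light P E σ T (P (x i)) (P (x j)) with hFL
  set FH := F.filter fun x => ¬ ∃ i j, H.Adj i j ∧ Light P E σ T (P (x i)) (P (x j)) with hFH
  have hlight : (FL.card : ℝ) ≤ F.card / 4 := by
    rw [← hσn]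
    refine le_trans ?_ (card_light_le P E hσ0.le (T := T) (by simp))
    exact_mod_cast hF.card_le (filter_subset _ _)
      (fun p => Light P E σ T (P p.1) (P p.2)) fun x hx => (mem_filter.1 hx).2
  have hheavy : (FH.card : ℝ) ≤ (E.filter fun p =>
      IsShattered P E α (3 / (4 * Δ)) k (P p.1) (P p.2)).card := by
    refine Nat.cast_le.2 (hF.card_le (filter_subset _ _) _ fun x hx => ?_)
    refine exists_shattered hE hα0 hα1 hη0 hη1 hη hασ hσ1 hr hΔ0 hΔ P hT hhom' ?_
    intro i j hij hl
    exact (mem_filter.1 hx).2 ⟨i, j, hij, hl⟩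
  have hsplit : (FL.card : ℝ) + FH.card = F.card := by
    exact_mod_cast card_filter_add_card_filter_not
      (s := F) fun x => ∃ i j, H.Adj i j ∧ Light P E σ T (P (x i)) (P (x j))
  obtain ⟨Q, hQ⟩ := exists_refinement_of_shattered P E (α := α) (θ := 3 / (4 * Δ)) hk0
  obtain ⟨Q', hQ'⟩ := exists_fin_coloring Q (k := T') (by
    refine le_trans (le_of_eq_of_le (b := T * (k * k) ^ T) ?_ ?_) hT'
    · simp
    · refine Nat.mul_le_mul_left _ (Nat.pow_le_pow_left ?_ _)
      rw [hk, ← pow_add]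
      refine Nat.pow_le_pow_right (by norm_num) ?_
      have : Fintype.card W * (2 ^ r - 1) ≤ Fintype.card W * 2 ^ r :=
        Nat.mul_le_mul_left _ (Nat.sub_le _ _)
      calc _ ≤ Fintype.card W * 2 ^ r + Fintype.card W * 2 ^ r := add_le_add this this
        _ = _ := by ring)
  refine ⟨Q', ?_⟩
  -- With `Z = ∅`, `logSum_refine` says that refining never lowers the sum.
  have h1 : logSum (pairMap Q) E ≤ logSum (pairMap Q') E := by
    have := logSum_refine (p := pairMap Q) (q := pairMap Q') (Z := ∅) E ?_ ?_
    · simpa using this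
    · rintro ⟨u, v⟩ ⟨u', v'⟩ h
      simp only [pairMap, Prod.mk.injEq] at h ⊢
      exact ⟨hQ' _ _ h.1, hQ' _ _ h.2⟩
    · simp
  refine le_trans ?_ (hQ.trans h1)
  refine add_le_add_right ?_ _
  have hΔ0' : (0 : ℝ) < Δ := by exact_mod_cast hΔ0
  have h2 : 3 / 4 * (F.card : ℝ) ≤ (E.filter fun p =>
      IsShattered P E α (3 / (4 * Δ)) k (P p.1) (P p.2)).card := by linarith
  -- The constant obtained is `3/8 * 3/4 = 9/32 ≥ 1/4`.
  calc (F.card : ℝ) / (4 * Δ) ≤ 3 / (4 * Δ) / 2 * (3 / 4 * (F.card : ℝ)) := by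
        rw [div_div, div_mul_eq_mul_div, div_le_div_iff₀ (by positivity) (by positivity)]
        have : (0 : ℝ) ≤ F.card * Δ := mul_nonneg (Nat.cast_nonneg _) hΔ0'.le
        linarith
    _ ≤ _ := mul_le_mul_of_nonneg_left h2 (div_nonneg (div_nonneg (by norm_num)
        (by linarith)) (by norm_num))

end


/-! ### Tower estimates for the parameters -/

lemma lt_towerOfTwos (k : ℕ) : k < towerOfTwos k := by
  induction k with
  | zero => simp [towerOfTwos]
  | succ k ih => exact lt_of_le_of_lt ih (Nat.lt_two_pow_self)

lemma two_pow_le_towerOfTwos (k : ℕ) : 2 ^ k ≤ towerOfTwos k := by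
  cases k with
  | zero => simp [towerOfTwos]
  | succ k => exact Nat.pow_le_pow_right (by norm_num) (lt_towerOfTwos k)

lemma towerOfTwos_mono : Monotone towerOfTwos :=
  monotone_nat_of_le_succ fun _ => Nat.lt_two_pow_self.le

/-- The number of parts after `j` refinements, starting from the trivial partition. -/
def partCount (c : ℕ) : ℕ → ℕ
  | 0 => 1
  | j + 1 => partCount c j * (2 ^ c) ^ partCount c j

lemma partCount_pos (c j : ℕ) : 0 < partCount c j := by
  induction j with
  | zero => simp [partCount]
  | succ j ih => simp only [partCount]; positivity

lemma partCount_mono (c : ℕ) : Monotone (partCount c) :=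
  monotone_nat_of_le_succ fun j => Nat.le_mul_of_pos_right _ (by positivity)

/-- The fourth power leaves room for the induction: with `t` parts and tower value `U`, `(c t)⁴ ≤
U²` gives `8 c t ≤ U`, while the next fourth power is at most `2 ^ (4 t + 4 c t)`. -/
lemma partCount_pow_le {c a : ℕ} (hc : 4 ≤ c) (ha : c ^ 4 ≤ towerOfTwos a) (j : ℕ) :
    partCount c j ^ 4 ≤ towerOfTwos (a + j) := by
  induction j with
  | zero =>
    simp only [partCount, one_pow]
    exact (Nat.one_le_pow _ _ (by omega)).trans ha
  | succ j ih =>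
    set t := partCount c j with ht
    set U := towerOfTwos (a + j) with hU
    have hcU : c ^ 4 ≤ U := ha.trans (towerOfTwos_mono (by omega))
    have h64 : 64 ≤ U := le_trans (by norm_num) ((Nat.pow_le_pow_left hc 4).trans hcU)
    have h1 : 8 * c * t ≤ U := by
      have h2 : (c * t) ^ 4 ≤ U ^ 2 := by
        rw [mul_pow, sq]; exact Nat.mul_le_mul hcU ih
      have h3 : (c * t) ^ 2 ≤ U := by
        refine (Nat.pow_le_pow_iff_left (n := 2) (by norm_num)).1 ?_
        rw [← pow_mul]; exact h2
      refine (Nat.pow_le_pow_iff_left (n := 2) (by norm_num)).1 ?_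
      calc (8 * c * t) ^ 2 = 64 * (c * t) ^ 2 := by ring
        _ ≤ U * U := Nat.mul_le_mul h64 h3
        _ = U ^ 2 := (sq U).symm
    calc (t * (2 ^ c) ^ t) ^ 4 ≤ (2 ^ t * (2 ^ c) ^ t) ^ 4 :=
          Nat.pow_le_pow_left (Nat.mul_le_mul_right _ Nat.lt_two_pow_self.le) 4
      _ = 2 ^ (4 * t + 4 * (c * t)) := by
          rw [← pow_mul, ← pow_add, ← pow_mul]; congr 1; ring
      _ ≤ 2 ^ U := by
          refine Nat.pow_le_pow_right (by norm_num) (le_trans ?_ h1)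
          have : t ≤ c * t := Nat.le_mul_of_pos_left _ (by omega)
          linarith

/-- The number of vertices that makes degenerate homomorphisms negligible is below the tower. -/
lemma pow_partCount_le_towerOfTwos {c a h Y : ℕ} (hc : 4 ≤ c) (ha : c ^ 4 ≤ towerOfTwos a)
    (hhc : h ≤ c) (hY : Y ≤ c) (K : ℕ) :
    (2 * (2 * Y ^ (h + 1) * partCount c K ^ 2 * h) ^ h) ^ h ≤ towerOfTwos (a + K + 2) := by
  have ht := partCount_pow_le hc ha K
  set t := partCount c K with htdef
  set U := towerOfTwos (a + K) with hU
  have hcU : c ^ 4 ≤ U := ha.trans (towerOfTwos_mono (by omega))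
  have h256 : 256 ≤ U := le_trans (by norm_num) ((Nat.pow_le_pow_left hc 4).trans hcU)
  have hct : c ^ 2 * t ≤ U := by
    rcases le_total t c with h1 | h1
    · calc c ^ 2 * t ≤ c ^ 2 * c ^ 2 := by
            refine Nat.mul_le_mul_left _ (h1.trans (Nat.le_self_pow (by norm_num) _))
        _ = c ^ 4 := by ring
        _ ≤ U := hcU
    · calc c ^ 2 * t ≤ t ^ 2 * t ^ 2 :=
            Nat.mul_le_mul (Nat.pow_le_pow_left h1 2) (Nat.le_self_pow (by norm_num) _)
        _ = t ^ 4 := by ring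
        _ ≤ U := ht
  -- All factors become powers of two; the final exponent is at most `8 U ≤ 2 ^ U`, which costs the
  -- two extra levels.
  have h1 : 2 * (2 * Y ^ (h + 1) * t ^ 2 * h) ^ h ≤ 2 ^ (c + (c * (h + 3) + 2 * t) * h) := by
    have e1 : 2 ≤ 2 ^ c := (show 2 = 2 ^ 1 by norm_num) ▸
      Nat.pow_le_pow_right (by norm_num) (by omega)
    have e2 : Y ≤ 2 ^ c := hY.trans Nat.lt_two_pow_self.le
    have e3 : h ≤ 2 ^ c := hhc.trans Nat.lt_two_pow_self.le
    have e4 : t ≤ 2 ^ t := Nat.lt_two_pow_self.le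
    calc 2 * (2 * Y ^ (h + 1) * t ^ 2 * h) ^ h
        ≤ 2 ^ c * (2 ^ c * (2 ^ c) ^ (h + 1) * (2 ^ t) ^ 2 * 2 ^ c) ^ h := by gcongr
      _ = 2 ^ (c + (c * (h + 3) + 2 * t) * h) := by
          simp only [← pow_mul, ← pow_add]; congr 1; ring
  have h2 : (c + (c * (h + 3) + 2 * t) * h) * h ≤ 8 * U := by
    calc (c + (c * (h + 3) + 2 * t) * h) * h
        = c * h + c * h ^ 3 + 3 * (c * h ^ 2) + 2 * (h ^ 2 * t) := by ring
      _ ≤ c * c ^ 3 + c * c ^ 3 + 3 * (c * c ^ 3) + 2 * (c ^ 2 * t) := by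
          have f1 : h ≤ c ^ 3 := hhc.trans (Nat.le_self_pow (by norm_num) _)
          have f2 : h ^ 2 ≤ c ^ 3 := (Nat.pow_le_pow_left hhc 2).trans
            (Nat.pow_le_pow_right (by omega) (by norm_num))
          gcongr
      _ = 5 * c ^ 4 + 2 * (c ^ 2 * t) := by ring
      _ ≤ 8 * U := by linarith
  have h3 : 8 * U ≤ 2 ^ U := by
    obtain ⟨u, hu⟩ : ∃ u, U = u + 4 := ⟨U - 4, by omega⟩
    rw [hu, pow_add]
    have := Nat.lt_two_pow_self (n := u)
    omega
  calc _ ≤ (2 ^ (c + (c * (h + 3) + 2 * t) * h)) ^ h := Nat.pow_le_pow_left h1 h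
    _ = 2 ^ ((c + (c * (h + 3) + 2 * t) * h) * h) := by rw [← pow_mul]
    _ ≤ 2 ^ (2 ^ U) := Nat.pow_le_pow_right (by norm_num) (h2.trans h3)

/-- The complexity of a single refinement is below a tower of slightly larger height. -/
lemma complexity_le_towerOfTwos {h Y b : ℕ} (hh : 1 ≤ h) (hY : 32 * h ^ 2 ≤ Y) (hb : Y ≤ 2 ^ b) :
    (2 * h * 2 ^ (12 * h ^ 2 * Y ^ (2 * h))) ^ 4 ≤ towerOfTwos (b + 3) := by
  have hhY : h ≤ Y := by nlinarith
  have hY32 : 32 ≤ Y := by nlinarith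
  set r := 12 * h ^ 2 * Y ^ (2 * h) with hr
  have hYh : Y ≤ Y ^ (2 * h) := Nat.le_self_pow (by omega) Y
  have h1 : 2 + h + r ≤ 2 * r := by
    have : 12 * Y ≤ r := by
      rw [hr]; nlinarith [Nat.mul_le_mul (show 1 ≤ h ^ 2 from Nat.one_le_pow _ _ hh) hYh]
    omega
  have h2 : 4 * (2 * r) ≤ Y ^ (2 * h + 2) := by
    calc 4 * (2 * r) = 3 * (32 * h ^ 2) * Y ^ (2 * h) := by rw [hr]; ring
      _ ≤ Y * Y * Y ^ (2 * h) := by gcongr; omega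
      _ = Y ^ (2 * h + 2) := by ring
  have h3 : Y * (2 * h + 2) ≤ 2 ^ Y := by
    have e1 : 2 * h + 2 ≤ Y := by nlinarith
    have e2 : Y ^ 2 < 2 ^ Y := by
      clear_value r
      have : ∀ m, 5 ≤ m → m ^ 2 < 2 ^ m := by
        intro m hm
        induction m, hm using Nat.le_induction with
        | base => norm_num
        | succ m hm ih => rw [pow_succ 2 m]; nlinarith
      exact this Y (by omega)
    nlinarith
  have h4 : 4 * (2 + h + r) ≤ 2 ^ 2 ^ Y := by
    calc 4 * (2 + h + r) ≤ 4 * (2 * r) := Nat.mul_le_mul_left _ h1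
      _ ≤ Y ^ (2 * h + 2) := h2
      _ ≤ (2 ^ Y) ^ (2 * h + 2) := Nat.pow_le_pow_left Nat.lt_two_pow_self.le _
      _ = 2 ^ (Y * (2 * h + 2)) := by rw [← pow_mul]
      _ ≤ 2 ^ 2 ^ Y := Nat.pow_le_pow_right (by norm_num) h3
  have hYt : Y ≤ towerOfTwos b := hb.trans (two_pow_le_towerOfTwos b)
  calc (2 * h * 2 ^ r) ^ 4 ≤ (2 ^ 2 * 2 ^ h * 2 ^ r) ^ 4 := by
        have := Nat.lt_two_pow_self (n := h)
        gcongr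
        norm_num
    _ = 2 ^ (4 * (2 + h + r)) := by
        rw [← pow_add, ← pow_add, ← pow_mul]; congr 1; ring
    _ ≤ 2 ^ 2 ^ 2 ^ Y := Nat.pow_le_pow_right (by norm_num) h4
    _ ≤ 2 ^ 2 ^ 2 ^ towerOfTwos b := by gcongr <;> norm_num

/-- The tower height in the removal lemma leaves room for all refinements. -/
lemma exists_height {h Δ f : ℕ} {ε L : ℝ} (hh : 2 ≤ h) (hΔ : Δ ≤ h ^ 2) (hε : 0 < ε)
    (hL0 : 0 ≤ L) (hL : L ≤ Real.log ε⁻¹ - Real.log 2)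
    (hf : f = ⌊5 * (h : ℝ) ^ 4 * Real.log ε⁻¹⌋₊) :
    ∃ K b : ℕ, 4 * (Δ : ℝ) ^ 2 * L < K ∧ b + 3 + K + 2 ≤ f ∧
      ⌈32 * (h : ℝ) ^ 2 / ε⌉₊ ≤ 2 ^ b := by
  set l := Real.log ε⁻¹ with hl
  have hlog2 := Real.log_two_gt_d9
  have hl0 : Real.log 2 ≤ l := by linarith
  have hh' : (2 : ℝ) ≤ h := by exact_mod_cast hh
  have hΔ' : (Δ : ℝ) ^ 2 ≤ (h : ℝ) ^ 4 := by
    have : (Δ : ℝ) ≤ (h : ℝ) ^ 2 := by exact_mod_cast hΔ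
    calc (Δ : ℝ) ^ 2 ≤ ((h : ℝ) ^ 2) ^ 2 := by gcongr
      _ = (h : ℝ) ^ 4 := by ring
  have hx0 : 0 ≤ 4 * (Δ : ℝ) ^ 2 * L := by positivity
  set K := ⌊4 * (Δ : ℝ) ^ 2 * L⌋₊ + 1 with hK
  have hK1 : 4 * (Δ : ℝ) ^ 2 * L < K := by rw [hK]; push_cast; exact Nat.lt_floor_add_one _
  have hK2 : (K : ℝ) ≤ 4 * h ^ 4 * (l - Real.log 2) + 1 := by
    have e1 := Nat.floor_le hx0
    have e2 : 4 * (Δ : ℝ) ^ 2 * L ≤ 4 * h ^ 4 * (l - Real.log 2) := by gcongr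
    rw [hK]; push_cast; linarith
  have hf1 : 5 * (h : ℝ) ^ 4 * l - 1 < f := by rw [hf]; exact Nat.sub_one_lt_floor _
  have hh3 : 8 * (h : ℝ) ≤ h ^ 4 := by
    have : (2 : ℝ) ^ 3 ≤ h ^ 3 := by gcongr
    nlinarith
  -- Refinements take at most `4 h⁴ (log ε⁻¹ - log 2) + 1` of about `5 h⁴ log ε⁻¹` levels. The rest,
  -- less five reserved levels, must dominate `log₂ (32 h² / ε)`; the `log 2` term absorbs the
  -- constants.
  have hgap : (h : ℝ) ^ 4 * l + 4 * h ^ 4 * Real.log 2 - 7 ≤ (f : ℝ) - K - 5 := by nlinarith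
  have hpos : (0 : ℝ) < (f : ℝ) - K - 5 := by
    have : (0 : ℝ) ≤ h ^ 4 * l := by nlinarith
    nlinarith
  have hKf : K + 5 ≤ f := by
    have : (K : ℝ) + 5 < f := by linarith
    exact_mod_cast this.le
  refine ⟨K, f - K - 5, hK1, by omega, ?_⟩
  have hb : ((f - K - 5 : ℕ) : ℝ) = f - K - 5 := by
    rw [Nat.sub_sub, Nat.cast_sub hKf]; push_cast; ring
  rw [Nat.ceil_le]
  push_cast
  rw [← Real.log_le_log_iff (by positivity) (by positivity), Real.log_pow, hb, div_eq_mul_inv,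
    Real.log_mul (by positivity) (by positivity), Real.log_mul (by norm_num) (by positivity),
    Real.log_pow, ← hl, show (32 : ℝ) = 2 ^ 5 by norm_num, Real.log_pow]
  have hlogh : Real.log h ≤ h - 1 := Real.log_le_sub_one_of_pos (by linarith)
  have hA : (h : ℝ) ^ 4 * (l + 4 * Real.log 2) - 7 ≤ (f : ℝ) - K - 5 := by linarith
  have hB := mul_le_mul_of_nonneg_right hA (by linarith : (0 : ℝ) ≤ Real.log 2)
  have hC : 8 * (h : ℝ) * (l + 4 * Real.log 2) ≤ h ^ 4 * (l + 4 * Real.log 2) :=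
    mul_le_mul_of_nonneg_right hh3 (by linarith)
  have hD : 8 * (h : ℝ) * (l + 2) ≤ 8 * (h : ℝ) * (l + 4 * Real.log 2) := by
    gcongr; linarith
  have hE : 16 * l + 16 * h ≤ 8 * (h : ℝ) * (l + 2) := by nlinarith
  have hF : (16 * l + 16 * h - 7) * Real.log 2 ≤ ((f : ℝ) - K - 5) * Real.log 2 :=
    mul_le_mul_of_nonneg_right (by linarith) (by linarith)
  have hlog2' := Real.log_two_lt_d9
  push_cast
  nlinarith [mul_nonneg (by linarith : (0 : ℝ) ≤ l) (by linarith : (0 : ℝ) ≤ Real.log 2 - 1 / 2),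
    mul_nonneg (by linarith : (0 : ℝ) ≤ (h : ℝ) - 2)
      (by linarith : (0 : ℝ) ≤ Real.log 2 - 1 / 2)]

/-! ### Iterating the refinement -/

section
open scoped Classical
open Finset

variable {V W : Type*} [Fintype V] [Fintype W]

lemma logSum_trivial (E : Finset (V × V)) (P : V → Fin 1) :
    logSum (pairMap P) E = E.card * Real.log (E.card / (Fintype.card V : ℝ) ^ 2) := by
  have h : ∀ p, cellDensity (pairMap P) E p = E.card / (Fintype.card V : ℝ) ^ 2 := by
    intro p
    have h1 : ∀ a, part P a = univ := fun a =>
      eq_univ_of_forall fun _ => mem_part.2 (Subsingleton.elim _ _)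
    have h2 : ∀ a b, between P E a b = E := fun a b => by
      ext p
      simp only [mem_between, and_iff_left_iff_imp]
      exact fun _ => ⟨Subsingleton.elim _ _, Subsingleton.elim _ _⟩
    rw [cellDensity_pairMap, h1, h1, h2, card_univ, sq]
  simp [logSum, h]

/-- A large packing of copies of `H` forces many homomorphisms. -/
lemma IsPacking.card_homsOn_gt {H : SimpleGraph W} {E : Finset (V × V)}
    (hE : ∀ u v, (u, v) ∈ E → (v, u) ∈ E) {F : Finset (W → V)} (hF : IsPacking H E F)
    {α η : ℝ} (hα0 : 0 < α) (hα1 : α ≤ 1)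
    (hη0 : 0 ≤ η) (hη1 : η ≤ 1) (hη : 2 * Fintype.card W * η ≤ α ^ Fintype.card W)
    (hασ : 8 * α ≤ F.card / (8 * Fintype.card V ^ 2))
    {r : ℕ} (hr : (1 - η ^ 2) ^ r ≤ 1 / 8) {Δ : ℕ} (hΔ0 : 0 < Δ)
    (hΔ : ((univ : Finset (W × W)).filter fun p => H.Adj p.1 p.2).card = Δ)
    (hEF : E.card = F.card * Δ) (hF0 : 0 < F.card) {K : ℕ}
    (hK : 4 * (Δ : ℝ) ^ 2 * Real.log (Fintype.card V ^ 2 / E.card) < K) :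
    (α ^ Fintype.card W / 2) ^ Fintype.card W / 8 *
        (8 * α / partCount (2 * Fintype.card W * 2 ^ r) K ^ 2 * Fintype.card V) ^ Fintype.card W <
      ((homsOn H E univ fun _ => univ).card : ℝ) := by
  by_contra! hhom
  set t := partCount (2 * Fintype.card W * 2 ^ r) with ht
  have step : ∀ j ≤ K, ∃ P : V → Fin (t j),
      E.card * Real.log (E.card / (Fintype.card V : ℝ) ^ 2) + j * (F.card / (4 * Δ)) ≤
        logSum (pairMap P) E := by
    intro j
    induction j with
    | zero =>
      intro _
      refine ⟨fun _ => (0 : Fin 1), ?_⟩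
      rw [← logSum_trivial E fun _ => 0]
      simp only [Nat.cast_zero, zero_mul, add_zero]
      exact le_rfl
    | succ j ih =>
      intro hj
      obtain ⟨P, hP⟩ := ih (by omega)
      have ht0 : (0 : ℝ) < t j := by exact_mod_cast partCount_pos _ j
      -- The assumed bound with the final number of parts implies the one needed at every earlier
      -- stage.
      have hmono : (t j : ℝ) ≤ t K := by exact_mod_cast partCount_mono _ (by omega : j ≤ K)
      obtain ⟨Q, hQ⟩ := exists_refinement hE hF hα0 hα1 hη0 hη1 hη hασ hr hΔ0 hΔ
        (T := t j) (T' := t (j + 1)) (partCount_pos _ j) (hhom.trans (by gcongr)) le_rfl P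
      refine ⟨Q, le_trans ?_ hQ⟩
      push_cast
      linarith
  obtain ⟨P, hP⟩ := step K le_rfl
  have h1 := hP.trans (logSum_nonpos _ _)
  have hΔ' : (0 : ℝ) < Δ := by exact_mod_cast hΔ0
  have hF' : (0 : ℝ) < F.card := by exact_mod_cast hF0
  have h2 : Real.log (E.card / (Fintype.card V : ℝ) ^ 2) =
      - Real.log (Fintype.card V ^ 2 / E.card) := by
    rw [← Real.log_inv, inv_div]
  rw [h2, hEF] at h1
  rw [hEF] at hK
  set L := Real.log ((Fintype.card V : ℝ) ^ 2 / ((F.card * Δ : ℕ) : ℝ)) with hL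
  have h3 : (K : ℝ) * (F.card / (4 * Δ)) ≤ F.card * Δ * L := by
    push_cast at h1; linarith
  have h4 : (4 * (Δ : ℝ) ^ 2 * L) * (F.card / (4 * Δ)) = F.card * Δ * L := by
    field_simp
  have h5 : (4 * (Δ : ℝ) ^ 2 * L) * (F.card / (4 * Δ)) < K * (F.card / (4 * Δ)) :=
    mul_lt_mul_of_pos_right hK (div_pos hF' (by linarith))
  linarith

end

/-! ### Copies, packings and the removal lemma -/

section
open scoped Classical
open Finset Function

variable {V W : Type*} [Fintype V] [Fintype W]

/-- The labelled copies of `H` in `G`, as maps of vertices. -/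
noncomputable def copyMaps (H : SimpleGraph W) (G : SimpleGraph V) : Finset (W → V) :=
  univ.filter fun x => Injective x ∧ ∀ i j, H.Adj i j → G.Adj (x i) (x j)

lemma mem_copyMaps {H : SimpleGraph W} {G : SimpleGraph V} {x : W → V} :
    x ∈ copyMaps H G ↔ Injective x ∧ ∀ i j, H.Adj i j → G.Adj (x i) (x j) := by
  simp [copyMaps]

/-- A labelled copy as an element of `SimpleGraph.Copy`. -/
def toCopy {H : SimpleGraph W} {G : SimpleGraph V} {x : W → V}
    (hx : Injective x ∧ ∀ i j, H.Adj i j → G.Adj (x i) (x j)) : H.Copy G :=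
  ⟨⟨x, fun {i j} h => hx.2 i j h⟩, hx.1⟩

/-- Every copy has at most `h ^ h` labellings. -/
lemma card_copyMaps_le (H : SimpleGraph W) (G : SimpleGraph V) :
    (copyMaps H G).card ≤ Fintype.card W ^ Fintype.card W * G.copyCount H := by
  have h1 : (copyMaps H G).card ≤ (univ : Finset (H.Copy G)).card := by
    refine card_le_card_of_surjOn (fun f : H.Copy G => (f : W → V)) ?_
    intro x hx
    exact ⟨toCopy (mem_copyMaps.1 (mem_coe.1 hx)), mem_coe.2 (mem_univ _), rfl⟩
  rw [SimpleGraph.copyCount_eq_card_image_copyToSubgraph]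
  refine h1.trans (card_le_mul_card_image _ _ fun G' hG' => ?_)
  obtain ⟨f₀, -, rfl⟩ := mem_image.1 hG'
  rw [← Fintype.card_fun, ← card_univ]
  have h2 : ∀ f : H.Copy G, f.toSubgraph = f₀.toSubgraph → ∀ i, ∃ j, f₀ j = f i := by
    intro f hf i
    have : f i ∈ f₀.toSubgraph.verts := by
      rw [← hf]; exact ⟨i, trivial, rfl⟩
    obtain ⟨j, -, hj⟩ := this
    exact ⟨j, hj⟩
  choose σ hσ using h2
  -- Labellings with the same image are `f₀ ∘ σ` with `σ : W → W`; the default `id` is never used on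
  -- the fibre.
  refine card_le_card_of_injOn
    (fun f => if hf : f.toSubgraph = f₀.toSubgraph then σ f hf else id) (fun _ _ => by simp) ?_
  intro f hf g hg hfg
  have hf := (mem_filter.1 (mem_coe.1 hf)).2
  have hg := (mem_filter.1 (mem_coe.1 hg)).2
  simp only [hf, hg, dif_pos] at hfg
  refine SimpleGraph.Copy.ext fun i => ?_
  rw [← hσ f hf i, ← hσ g hg i, hfg]

lemma card_filter_apply_eq_le {i j : W} (hij : i ≠ j) :
    ((univ : Finset (W → V)).filter fun x => x i = x j).card ≤
      Fintype.card V ^ (Fintype.card W - 1) := by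
  have h1 : Fintype.card ({l : W // l ≠ j} → V) = Fintype.card V ^ (Fintype.card W - 1) := by
    simp [Fintype.card_subtype_compl]
  rw [← h1, ← card_univ]
  refine card_le_card_of_injOn (fun x l => x l) (fun _ _ => by simp) ?_
  intro x hx y hy hxy
  have hx := (mem_filter.1 (mem_coe.1 hx)).2
  have hy := (mem_filter.1 (mem_coe.1 hy)).2
  have h2 : ∀ l, l ≠ j → x l = y l := fun l hl => congrFun hxy ⟨l, hl⟩
  ext l
  by_cases hl : l = j
  · rw [hl, ← hx, ← hy]; exact h2 i hij
  · exact h2 l hl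

/-- A homomorphism is injective, hence a labelled copy, or it identifies one of at most `h ^ 2`
pairs of vertices. -/
lemma card_homsOn_le {H : SimpleGraph W} {G : SimpleGraph V} {E : Finset (V × V)}
    (hE : ∀ p ∈ E, G.Adj p.1 p.2) :
    (homsOn H E univ fun _ => univ).card ≤
      Fintype.card W ^ Fintype.card W * G.copyCount H +
        Fintype.card W ^ 2 * Fintype.card V ^ (Fintype.card W - 1) := by
  have hsub : (homsOn H E univ fun _ => univ) ⊆ copyMaps H G ∪
      ((univ : Finset (W × W)).filter fun p => p.1 ≠ p.2).biUnion fun p =>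
        (univ : Finset (W → V)).filter fun x => x p.1 = x p.2 := by
    intro x hx
    rw [mem_homsOn] at hx
    rw [mem_union]
    by_cases hinj : Injective x
    · left
      exact mem_copyMaps.2 ⟨hinj, fun i j hij => hE _ (hx.2 i (mem_univ _) j (mem_univ _) hij)⟩
    · right
      simp only [Injective, not_forall] at hinj
      obtain ⟨i, j, h, hij⟩ := hinj
      exact mem_biUnion.2 ⟨(i, j), mem_filter.2 ⟨mem_univ _, hij⟩, mem_filter.2 ⟨mem_univ _, h⟩⟩
  refine (card_le_card hsub).trans ((card_union_le _ _).trans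
    (add_le_add (card_copyMaps_le H G) ?_))
  refine (card_biUnion_le_card_mul _ _ (Fintype.card V ^ (Fintype.card W - 1)) ?_).trans ?_
  · intro p hp
    exact card_filter_apply_eq_le (mem_filter.1 hp).2
  · refine Nat.mul_le_mul_right _ ((card_le_univ _).trans_eq ?_)
    rw [Fintype.card_prod, sq]

/-- There is a maximal family of edge-disjoint labelled copies of `H` in `G`. -/
lemma exists_maximal_packing (H : SimpleGraph W) (G : SimpleGraph V) :
    ∃ F ⊆ copyMaps H G,
      (∀ x ∈ F, ∀ y ∈ F, ∀ i j k l, H.Adj i j → H.Adj k l → (x i, x j) = (y k, y l) → x = y) ∧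
      (H ≠ ⊥ → ∀ y ∈ copyMaps H G, ∃ x ∈ F, ∃ i j k l, H.Adj i j ∧ H.Adj k l ∧
        (x i, x j) = (y k, y l)) := by
  obtain ⟨F, hF, hmax⟩ := exists_max_image ((copyMaps H G).powerset.filter fun F =>
    ∀ x ∈ F, ∀ y ∈ F, ∀ i j k l, H.Adj i j → H.Adj k l → (x i, x j) = (y k, y l) → x = y)
    card ⟨∅, by simp⟩
  rw [mem_filter, mem_powerset] at hF
  refine ⟨F, hF.1, hF.2, fun hH y hy => ?_⟩
  by_contra! hc
  obtain ⟨a, b, hab⟩ := SimpleGraph.ne_bot_iff_exists_adj.1 hH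
  have hyF : y ∉ F := fun h => hc y h a b a b hab hab rfl
  have := hmax (insert y F) (by
    rw [mem_filter, mem_powerset]
    refine ⟨insert_subset hy hF.1, ?_⟩
    intro x hx z hz i j k l hij hkl h
    rcases mem_insert.1 hx with hx | hx <;> rcases mem_insert.1 hz with hz | hz
    · rw [hx, hz]
    · exact absurd (hx ▸ h.symm) (hc z hz k l i j hkl hij)
    · exact absurd (hz ▸ h) (hc x hx i j k l hij hkl)
    · exact hF.2 x hx z hz i j k l hij hkl h)
  rw [card_insert_of_notMem hyF] at this
  omega

/-- The darts of `H`. -/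
noncomputable def darts (H : SimpleGraph W) : Finset (W × W) := univ.filter fun p => H.Adj p.1 p.2

lemma card_darts (H : SimpleGraph W) : (darts H).card = 2 * H.edgeFinset.card := by
  rw [← H.dart_card_eq_twice_card_edges, ← card_univ]
  symm
  refine card_bij (fun d _ => d.toProd) (fun d _ => mem_filter.2 ⟨mem_univ _, d.adj⟩)
    (fun d _ d' _ h => SimpleGraph.Dart.ext _ _ h)
    fun p hp => ⟨⟨p, (mem_filter.1 hp).2⟩, mem_univ _, rfl⟩

lemma card_darts_le (H : SimpleGraph W) : (darts H).card ≤ Fintype.card W ^ 2 :=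
  (card_le_univ _).trans_eq (by rw [Fintype.card_prod, sq])

/-- A graph with few copies of `H` has few homomorphisms from `H`, once it has one copy. -/
lemma card_homs_le_of_copies {h n Y t : ℕ} {C Θ X : ℝ} (hh : 2 ≤ h) (hY : 0 < Y) (ht : 0 < t)
    (hX : X ≤ h ^ h * C + h ^ 2 * (n : ℝ) ^ (h - 1)) (hC : 1 ≤ C) (hΘ : Θ * C ≤ (n : ℝ) ^ h)
    (hR : (2 * (2 * (Y : ℝ) ^ (h + 1) * t ^ 2 * h) ^ h) ^ h ≤ Θ) :
    X ≤ ((1 / (Y : ℝ)) ^ h / 2) ^ h / 8 * (8 * (1 / (Y : ℝ)) / t ^ 2 * n) ^ h := by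
  have hY1 : (1 : ℝ) ≤ Y := by exact_mod_cast hY
  have ht1 : (1 : ℝ) ≤ t := by exact_mod_cast ht
  have hh1 : (2 : ℝ) ≤ h := by exact_mod_cast hh
  have hA1 : (1 : ℝ) ≤ (2 * (Y : ℝ) ^ (h + 1) * t ^ 2) ^ h := by
    refine one_le_pow₀ ?_
    have h1 : (1 : ℝ) ≤ (Y : ℝ) ^ (h + 1) := one_le_pow₀ hY1
    have h2 : (1 : ℝ) ≤ (t : ℝ) ^ 2 := one_le_pow₀ ht1
    nlinarith
  set A : ℝ := (2 * (Y : ℝ) ^ (h + 1) * t ^ 2) ^ h with hA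
  have hRA : 2 * (2 * (Y : ℝ) ^ (h + 1) * t ^ 2 * h) ^ h = 2 * A * h ^ h := by
    rw [mul_pow _ (h : ℝ), hA]; ring
  rw [hRA] at hR
  have hhh : (1 : ℝ) ≤ (h : ℝ) ^ h := one_le_pow₀ (by linarith)
  have hR1 : 1 ≤ 2 * A * (h : ℝ) ^ h := by nlinarith
  have hRΘ : 2 * A * (h : ℝ) ^ h ≤ Θ := (le_self_pow₀ hR1 (by omega)).trans hR
  have hΘ0 : 0 ≤ Θ := le_trans (by linarith) hRΘ
  -- A single copy already forces `Θ ≤ n ^ h`, so `n` is large and degenerate homomorphisms are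
  -- negligible.
  have hRn : 2 * A * (h : ℝ) ^ h ≤ n := by
    refine (pow_le_pow_iff_left₀ (by linarith) (Nat.cast_nonneg _) (by omega : h ≠ 0)).1 ?_
    exact hR.trans ((le_mul_of_one_le_right hΘ0 hC).trans hΘ)
  have hn1 : (n : ℝ) ^ h = n * (n : ℝ) ^ (h - 1) := by
    rw [← pow_succ', Nat.sub_add_cancel (by omega)]
  have hh2 : (h : ℝ) ^ 2 ≤ (h : ℝ) ^ h := pow_le_pow_right₀ (by linarith) hh
  have hn0 : (0 : ℝ) ≤ (n : ℝ) ^ (h - 1) := pow_nonneg (Nat.cast_nonneg _) _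
  have h1 : A * (h ^ h * C) ≤ (n : ℝ) ^ h / 2 := by
    have : 2 * A * (h : ℝ) ^ h * C ≤ Θ * C := mul_le_mul_of_nonneg_right hRΘ (by linarith)
    linarith
  have h2 : A * (h ^ 2 * (n : ℝ) ^ (h - 1)) ≤ (n : ℝ) ^ h / 2 := by
    have h3 : 2 * A * (h : ℝ) ^ 2 ≤ n :=
      (mul_le_mul_of_nonneg_left hh2 (by linarith)).trans hRn
    have := mul_le_mul_of_nonneg_right h3 hn0
    rw [hn1]
    linarith
  have hAX : A * X ≤ (n : ℝ) ^ h := by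
    have := mul_le_mul_of_nonneg_left hX (by linarith : 0 ≤ A)
    linarith
  have h8 : (8 : ℝ) ≤ 8 ^ h := le_self_pow₀ (by norm_num) (by omega)
  have hrhs : ((1 / (Y : ℝ)) ^ h / 2) ^ h / 8 * (8 * (1 / (Y : ℝ)) / t ^ 2 * n) ^ h =
      8 ^ h / 8 * ((n : ℝ) ^ h / A) := by
    have e1 : (1 / (Y : ℝ)) ^ h / 2 * (8 * (1 / (Y : ℝ)) / t ^ 2 * n) =
        8 * (n / (2 * (Y : ℝ) ^ (h + 1) * t ^ 2)) := by
      rw [pow_succ, one_div, inv_pow]; field_simp; ring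
    rw [div_mul_eq_mul_div, ← mul_pow, e1, mul_pow, div_pow, ← hA]; ring
  rw [hrhs]
  have h3 : X ≤ (n : ℝ) ^ h / A := by rw [le_div_iff₀ (by linarith)]; linarith
  refine h3.trans (le_mul_of_one_le_left (by positivity) ?_)
  linarith

/-- A maximal family of edge-disjoint copies of `H` with few edges gives a small set of edges which
meets all copies of `H`. -/
lemma exists_deletion_of_packing {H : SimpleGraph W} {G : SimpleGraph V} {ε : ℝ}
    {F : Finset (W → V)} (hFsub : F ⊆ copyMaps H G)
    (hFmax : ∀ y ∈ copyMaps H G, ∃ x ∈ F, ∃ i j k l, H.Adj i j ∧ H.Adj k l ∧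
        (x i, x j) = (y k, y l))
    (hle : F.card * ((darts H).card : ℝ) ≤ 2 * (ε * (Fintype.card V : ℝ) ^ 2)) :
    ∃ S : Finset (Sym2 V), (S : Set (Sym2 V)) ⊆ G.edgeSet ∧
      (S.card : ℝ) ≤ ε * (Fintype.card V : ℝ) ^ 2 ∧
      H.Free (G.deleteEdges (S : Set (Sym2 V))) := by
  refine ⟨F.biUnion fun x => H.edgeFinset.image (Sym2.map x), ?_, ?_, ?_⟩
  · intro e he
    rw [mem_coe, mem_biUnion] at he
    obtain ⟨x, hx, he⟩ := he
    obtain ⟨e', he', rfl⟩ := mem_image.1 he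
    have hx := (mem_copyMaps.1 (hFsub hx)).2
    induction e' using Sym2.inductionOn with
    | hf i j => exact hx i j (SimpleGraph.mem_edgeFinset.1 he')
  · have h1 : (F.biUnion fun x => H.edgeFinset.image (Sym2.map x)).card ≤
        F.card * H.edgeFinset.card :=
      card_biUnion_le_card_mul _ _ _ fun x _ => card_image_le
    have h2 : ((darts H).card : ℝ) = 2 * H.edgeFinset.card := by exact_mod_cast card_darts H
    have h3 : ((F.biUnion fun x => H.edgeFinset.image (Sym2.map x)).card : ℝ) ≤
        F.card * H.edgeFinset.card := by exact_mod_cast h1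
    rw [h2] at hle
    linarith
  · rintro ⟨y⟩
    have hy : ∀ i j, H.Adj i j → (G.deleteEdges (F.biUnion fun x =>
      H.edgeFinset.image (Sym2.map x) : Set (Sym2 V))).Adj (y i) (y j) :=
      fun i j hij => y.toHom.map_adj hij
    obtain ⟨x, hx, i, j, k, l, hij, hkl, heq⟩ := hFmax (fun i => y i) (mem_copyMaps.2
      ⟨y.injective, fun i j hij => (SimpleGraph.deleteEdges_adj.1 (hy i j hij)).1⟩)
    refine (SimpleGraph.deleteEdges_adj.1 (hy k l hkl)).2 ?_
    rw [mem_coe, mem_biUnion]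
    refine ⟨x, hx, mem_image.2 ⟨s(i, j), SimpleGraph.mem_edgeFinset.2 hij, ?_⟩⟩
    rw [Prod.mk.injEq] at heq
    rw [Sym2.map_mk, heq.1, heq.2]

/-- The set of pairs used by a family of edge-disjoint copies. -/
lemma exists_packing_pairs {H : SimpleGraph W} {G : SimpleGraph V} {F : Finset (W → V)}
    (hFsub : F ⊆ copyMaps H G)
    (hFdisj : ∀ x ∈ F, ∀ y ∈ F, ∀ i j k l, H.Adj i j → H.Adj k l →
      (x i, x j) = (y k, y l) → x = y) :
    ∃ E : Finset (V × V), (∀ u v, (u, v) ∈ E → (v, u) ∈ E) ∧ (∀ p ∈ E, G.Adj p.1 p.2) ∧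
      E.card = F.card * (darts H).card ∧ IsPacking H E F := by
  set E : Finset (V × V) := (F ×ˢ darts H).image fun q => (q.1 q.2.1, q.1 q.2.2) with hEdef
  have hmemE : ∀ x ∈ F, ∀ i j, H.Adj i j → (x i, x j) ∈ E := fun x hx i j hij =>
    mem_image.2 ⟨(x, (i, j)), mem_product.2 ⟨hx, mem_filter.2 ⟨mem_univ _, hij⟩⟩, rfl⟩
  have hEex : ∀ p ∈ E, ∃ x ∈ F, ∃ i j, H.Adj i j ∧ (x i, x j) = p := by
    intro p hp
    obtain ⟨⟨x, i, j⟩, hq, rfl⟩ := mem_image.1 hp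
    have hq := mem_product.1 hq
    exact ⟨x, hq.1, i, j, (mem_filter.1 hq.2).2, rfl⟩
  have hEsymm : ∀ u v, (u, v) ∈ E → (v, u) ∈ E := by
    intro u v huv
    obtain ⟨x, hx, i, j, hij, heq⟩ := hEex _ huv
    rw [Prod.mk.injEq] at heq
    rw [← heq.1, ← heq.2]
    exact hmemE x hx j i hij.symm
  have hEG : ∀ p ∈ E, G.Adj p.1 p.2 := by
    intro p hp
    obtain ⟨x, hx, i, j, hij, rfl⟩ := hEex _ hp
    exact (mem_copyMaps.1 (hFsub hx)).2 i j hij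
  have hEF : E.card = F.card * (darts H).card := by
    rw [hEdef, card_image_of_injOn, card_product]
    rintro ⟨x, i, j⟩ hq ⟨y, k, l⟩ hq' heq
    have hq := mem_product.1 (mem_coe.1 hq)
    have hq' := mem_product.1 (mem_coe.1 hq')
    have hxy := hFdisj x hq.1 y hq'.1 i j k l (mem_filter.1 hq.2).2 (mem_filter.1 hq'.2).2 heq
    subst hxy
    have hinj := (mem_copyMaps.1 (hFsub hq.1)).1
    have heq : x i = x k ∧ x j = x l := Prod.mk.injEq _ _ _ _ ▸ heq
    rw [hinj heq.1, hinj heq.2]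
  exact ⟨E, hEsymm, hEG, hEF, hmemE, hFdisj⟩

/-- The parameters of the counting lemma. -/
lemma exists_regularity_parameter {h Y : ℕ} (hh2 : 2 ≤ h) (hYpos : 0 < Y) :
    ∃ η : ℝ, 0 ≤ η ∧ η ≤ 1 ∧ 2 * (h : ℝ) * η ≤ (1 / (Y : ℝ)) ^ h ∧
      (1 - η ^ 2) ^ (12 * h ^ 2 * Y ^ (2 * h)) ≤ 1 / 8 := by
  have hY1 : (1 : ℝ) ≤ Y := by exact_mod_cast hYpos
  have hYh0 : (0 : ℝ) < (Y : ℝ) ^ h := pow_pos (by linarith) _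
  have hh0 : (2 : ℝ) ≤ h := by exact_mod_cast hh2
  set η : ℝ := 1 / (2 * h * (Y : ℝ) ^ h) with hηdef
  have hYh1 : (1 : ℝ) ≤ (Y : ℝ) ^ h := one_le_pow₀ hY1
  have hden : (1 : ℝ) ≤ 2 * h * (Y : ℝ) ^ h := by nlinarith
  have hη0 : 0 ≤ η := one_div_nonneg.2 (by linarith)
  have hη1 : η ≤ 1 := (div_le_one (by linarith)).2 hden
  have hη : 2 * (h : ℝ) * η ≤ (1 / (Y : ℝ)) ^ h := by
    rw [hηdef, one_div_pow]
    apply le_of_eq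
    field_simp
  set r := 12 * h ^ 2 * Y ^ (2 * h) with hrdef
  have hr : (1 - η ^ 2) ^ r ≤ 1 / 8 := by
    have h1 : (1 - η ^ 2) ^ r ≤ Real.exp (-(η ^ 2)) ^ r := by
      refine pow_le_pow_left₀ (by nlinarith) ?_ r
      linarith [Real.add_one_le_exp (-(η ^ 2))]
    -- The exponent `r` is `3 / η ^ 2`, chosen because `e⁻³ ≤ 1/8`.
    have h2 : (r : ℝ) * -(η ^ 2) = -3 := by
      rw [hrdef, hηdef]; push_cast; rw [mul_comm 2 h, pow_mul]; field_simp; norm_num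
    rw [← Real.exp_nat_mul, h2, Real.exp_neg] at h1
    refine h1.trans ?_
    rw [inv_eq_one_div]
    refine one_div_le_one_div_of_le (by norm_num) ?_
    have h3 : (2 : ℝ) ≤ Real.exp 1 := by linarith [Real.add_one_le_exp (1 : ℝ)]
    calc (8 : ℝ) = 2 ^ 3 := by norm_num
      _ ≤ Real.exp 1 ^ 3 := by gcongr
      _ = Real.exp 3 := by rw [← Real.exp_nat_mul]; norm_num
  exact ⟨η, hη0, hη1, hη, hr⟩

/-- The removal lemma for graphs with at least one edge. -/
lemma removal_of_ne_bot {H : SimpleGraph W} (hH : H ≠ ⊥) {ε : ℝ} (hε0 : 0 < ε)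
    {f : ℕ} (hf : f = ⌊5 * (Fintype.card W : ℝ) ^ 4 * Real.log ε⁻¹⌋₊) (G : SimpleGraph V)
    (hG : (towerOfTwos f : ℝ) * G.copyCount H ≤ (Fintype.card V : ℝ) ^ Fintype.card W) :
    ∃ S : Finset (Sym2 V), (S : Set (Sym2 V)) ⊆ G.edgeSet ∧
      (S.card : ℝ) ≤ ε * (Fintype.card V : ℝ) ^ 2 ∧
      H.Free (G.deleteEdges (S : Set (Sym2 V))) := by
  by_contra hno
  obtain ⟨F, hFsub, hFdisj, hFmax⟩ := exists_maximal_packing H G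
  have hFmax := hFmax hH
  obtain ⟨a, b, hab⟩ := SimpleGraph.ne_bot_iff_exists_adj.1 hH
  set h := Fintype.card W with hh
  set n := Fintype.card V with hn
  set Δ := (darts H).card with hΔ
  have hΔ0 : 0 < Δ := card_pos.2 ⟨(a, b), mem_filter.2 ⟨mem_univ _, hab⟩⟩
  have hh2 : 2 ≤ h := Fintype.one_lt_card_iff.2 ⟨a, b, hab.ne⟩
  have hlarge : 2 * (ε * (n : ℝ) ^ 2) < F.card * Δ := by
    by_contra! hle
    exact hno (exists_deletion_of_packing hFsub hFmax hle)
  have hFΔ0 : (0 : ℝ) < F.card * Δ := lt_of_le_of_lt (by positivity) hlarge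
  have hF0 : 0 < F.card := by
    rcases Nat.eq_zero_or_pos F.card with h0 | h0
    · rw [h0] at hFΔ0; simp at hFΔ0
    · exact h0
  obtain ⟨x₀, hx₀⟩ := card_pos.1 hF0
  have hx₀' := mem_copyMaps.1 (hFsub hx₀)
  have hn0 : 0 < n := Fintype.card_pos_iff.2 ⟨x₀ a⟩
  have hn0' : (0 : ℝ) < n := by exact_mod_cast hn0
  obtain ⟨E, hEsymm, hEG, hEF, hpack⟩ := exists_packing_pairs hFsub hFdisj
  have hEn : (E.card : ℝ) ≤ n ^ 2 := by
    have : E.card ≤ n ^ 2 := (card_le_univ _).trans_eq (by rw [Fintype.card_prod, sq])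
    exact_mod_cast this
  have hEF' : (E.card : ℝ) = F.card * Δ := by exact_mod_cast hEF
  set L := Real.log ((n : ℝ) ^ 2 / E.card) with hLdef
  have hL0 : 0 ≤ L := Real.log_nonneg ((one_le_div (hEF' ▸ hFΔ0)).2 hEn)
  -- Ordered pairs count edges twice, so `|E| > 2 ε n²`; this yields the `log 2` that
  -- `exists_height` needs.
  have hL : L ≤ Real.log ε⁻¹ - Real.log 2 := by
    rw [← Real.log_div (inv_pos.2 hε0).ne' (by norm_num)]
    refine Real.log_le_log (div_pos (pow_pos hn0' 2) (hEF' ▸ hFΔ0)) ?_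
    rw [hEF', div_le_iff₀ hFΔ0, inv_eq_one_div, div_div, one_div, ← div_eq_inv_mul,
      le_div_iff₀ (mul_pos hε0 two_pos)]
    linarith
  obtain ⟨K, b, hK, hbf, hYb⟩ := exists_height hh2 (card_darts_le H) hε0 hL0 hL hf
  -- With `α = 1 / Y`, `8 α ≤ ε / (4 h²)`, which is below `|F| / (8 n²)` because `|F| h² > 2 ε n²`.
  set Y := ⌈32 * (h : ℝ) ^ 2 / ε⌉₊ with hYdef
  have hε1 : ε ≤ 1 := by
    have h1 : 2 * (ε * (n : ℝ) ^ 2) < n ^ 2 := hlarge.trans_le (hEF' ▸ hEn)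
    have h2 : (0 : ℝ) < n ^ 2 := pow_pos hn0' 2
    by_contra! hc
    nlinarith
  have hYε : 32 * (h : ℝ) ^ 2 / ε ≤ Y := Nat.le_ceil _
  have hY32 : 32 * h ^ 2 ≤ Y := by
    have : 32 * (h : ℝ) ^ 2 ≤ Y := by
      refine le_trans ?_ hYε
      rw [le_div_iff₀ hε0]
      exact mul_le_of_le_one_right (by positivity) hε1
    exact_mod_cast this
  have hYpos : 0 < Y := by nlinarith
  have hY1 : (1 : ℝ) ≤ Y := by exact_mod_cast hYpos
  set r := 12 * h ^ 2 * Y ^ (2 * h) with hrdef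
  set c := 2 * h * 2 ^ r with hcdef
  have hca : c ^ 4 ≤ towerOfTwos (b + 3) := complexity_le_towerOfTwos (by omega) hY32 hYb
  have hrc : r ≤ c := Nat.lt_two_pow_self.le.trans (Nat.le_mul_of_pos_left _ (by omega))
  have hYr : Y ≤ r := by
    calc Y ≤ Y ^ (2 * h) := Nat.le_self_pow (by omega) Y
      _ ≤ r := Nat.le_mul_of_pos_left _ (by positivity)
  have hhY : h ≤ Y := by nlinarith
  have hc4 : 4 ≤ c := by nlinarith
  have hh0 : (2 : ℝ) ≤ h := by exact_mod_cast hh2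
  obtain ⟨η, hη0, hη1, hη, hr⟩ := exists_regularity_parameter hh2 hYpos
  have hασ : 8 * (1 / (Y : ℝ)) ≤ F.card / (8 * (n : ℝ) ^ 2) := by
    have hΔh : (Δ : ℝ) ≤ h ^ 2 := by exact_mod_cast card_darts_le H
    have h1 : 32 * (h : ℝ) ^ 2 ≤ Y * ε := (div_le_iff₀ hε0).1 hYε
    have h2 : 2 * (ε * (n : ℝ) ^ 2) ≤ F.card * h ^ 2 :=
      hlarge.le.trans (mul_le_mul_of_nonneg_left hΔh (Nat.cast_nonneg _))
    have h3 : (h : ℝ) ^ 2 * (64 * (n : ℝ) ^ 2) ≤ h ^ 2 * (F.card * Y) := by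
      calc (h : ℝ) ^ 2 * (64 * (n : ℝ) ^ 2) = 32 * (h : ℝ) ^ 2 * (2 * (n : ℝ) ^ 2) := by ring
        _ ≤ Y * ε * (2 * (n : ℝ) ^ 2) :=
          mul_le_mul_of_nonneg_right h1 (mul_nonneg (by norm_num) (sq_nonneg _))
        _ = Y * (2 * (ε * (n : ℝ) ^ 2)) := by ring
        _ ≤ Y * (F.card * h ^ 2) := mul_le_mul_of_nonneg_left h2 (by linarith)
        _ = _ := by ring
    have h4 := le_of_mul_le_mul_left h3 (pow_pos (by linarith) 2)
    rw [mul_one_div, div_le_div_iff₀ (by linarith) (mul_pos (by norm_num) (pow_pos hn0' 2))]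
    linarith
  have hgt := hpack.card_homsOn_gt hEsymm (one_div_pos.2 (by linarith))
    ((div_le_one (by linarith)).2 hY1) hη0 hη1 hη hασ hr hΔ0 rfl hEF hF0 hK
  refine hgt.not_ge (card_homs_le_of_copies hh2 hYpos (partCount_pos _ K) (C := G.copyCount H)
    (Θ := towerOfTwos f) ?_ ?_ hG ?_)
  · have := card_homsOn_le (H := H) hEG
    exact_mod_cast this
  · exact_mod_cast SimpleGraph.copyCount_pos.2 ⟨toCopy hx₀'⟩
  · exact_mod_cast (pow_partCount_le_towerOfTwos hc4 hca ((hhY.trans hYr).trans hrc)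
      (hYr.trans hrc) K).trans (towerOfTwos_mono hbf)

/-- The removal lemma for graphs without edges. -/
lemma free_of_bot [Nonempty W] {ε : ℝ} (hε0 : 0 < ε) (hε : ε < 1 / 2)
    {f : ℕ} (hf : f = ⌊5 * (Fintype.card W : ℝ) ^ 4 * Real.log ε⁻¹⌋₊) (G : SimpleGraph V)
    (hG : (towerOfTwos f : ℝ) * G.copyCount (⊥ : SimpleGraph W) ≤
      (Fintype.card V : ℝ) ^ Fintype.card W) :
    (⊥ : SimpleGraph W).Free G := by
  by_contra hfree
  have hC : 0 < G.copyCount (⊥ : SimpleGraph W) :=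
    SimpleGraph.copyCount_pos.2 hfree
  obtain ⟨g⟩ := hfree
  set h := Fintype.card W with hh
  set n := Fintype.card V with hn
  have hh1 : 1 ≤ h := Fintype.card_pos
  have hhn : h ≤ n := Fintype.card_le_of_injective g g.injective
  -- For `1 ≤ h ≤ n` one has `n ≤ h (n - h + 1)`; hence there are at least `n ^ h / h ^ (2 h)`
  -- copies.
  have h1 : n ^ h ≤ h ^ h * n.descFactorial h := by
    calc n ^ h ≤ (h * (n + 1 - h)) ^ h := by
          refine Nat.pow_le_pow_left ?_ h
          obtain ⟨m, hm⟩ := Nat.exists_eq_add_of_le hhn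
          rw [hm, show h + m + 1 - h = m + 1 by omega]
          nlinarith
      _ ≤ _ := by
          rw [mul_pow]
          exact Nat.mul_le_mul_left _ (Nat.pow_sub_le_descFactorial n h)
  have h2 : n.descFactorial h ≤ (copyMaps (⊥ : SimpleGraph W) G).card := by
    rw [hn, hh, ← Fintype.card_embedding_eq, ← card_univ]
    exact card_le_card_of_injOn (fun e => e)
      (fun e _ => mem_coe.2 (mem_copyMaps.2 ⟨e.injective, fun _ _ h => h.elim⟩))
      fun e _ e' _ h => DFunLike.coe_injective h
  have h3 : n ^ h ≤ h ^ h * (h ^ h * G.copyCount (⊥ : SimpleGraph W)) :=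
    h1.trans (Nat.mul_le_mul_left _ (h2.trans (card_copyMaps_le _ _)))
  have h4 : towerOfTwos f * G.copyCount (⊥ : SimpleGraph W) ≤ n ^ h := by exact_mod_cast hG
  have h5 : towerOfTwos f ≤ h ^ h * h ^ h := by
    refine Nat.le_of_mul_le_mul_right (le_trans h4 (h3.trans_eq ?_)) hC
    ring
  have h6 : h ^ h * h ^ h ≤ 2 ^ (2 * h ^ 2) := by
    calc h ^ h * h ^ h ≤ (2 ^ h) ^ h * (2 ^ h) ^ h := by
          have := Nat.lt_two_pow_self (n := h)
          gcongr
      _ = _ := by rw [← pow_mul, ← pow_add]; congr 1; ring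
  -- Here `ε < 1/2` enters, through `5 log 2 > 3`; the tower then exceeds `2 ^ (2 h²)`, a bound for
  -- `h ^ (2 h)`.
  have h7 : 3 * h ^ 4 ≤ f := by
    rw [hf]
    refine Nat.le_floor ?_
    have e1 : Real.log 2 ≤ Real.log ε⁻¹ := by
      refine Real.log_le_log (by norm_num) ?_
      rw [le_inv_comm₀ (by norm_num) hε0]
      linarith
    have e2 := Real.log_two_gt_d9
    have e3 : (0 : ℝ) ≤ (h : ℝ) ^ 4 := by positivity
    push_cast
    nlinarith
  have h8 : 2 * h ^ 2 < 3 * h ^ 4 := by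
    have : 1 ≤ h ^ 2 := Nat.one_le_pow _ _ hh1
    nlinarith [show h ^ 4 = h ^ 2 * h ^ 2 by ring]
  have h9 := (two_pow_le_towerOfTwos f).trans (h5.trans h6)
  have := (Nat.pow_le_pow_iff_right (by norm_num)).1 h9
  omega

end
end GraphRemoval

theorem theorem1 {W : Type*} [Fintype W] [Nonempty W] (H : SimpleGraph W)
    (ε : ℝ) (hε0 : 0 < ε) (hε1 : ε < 1) (hH : H = ⊥ → ε < 1 / 2)
    (δ : ℝ)
    (hδ : δ⁻¹ = (towerOfTwos ⌊5 * (Fintype.card W : ℝ) ^ 4 * Real.log ε⁻¹⌋₊ : ℝ))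
    {V : Type*} [Fintype V] (G : SimpleGraph V)
    (hG : (G.copyCount H : ℝ) ≤ δ * (Fintype.card V : ℝ) ^ Fintype.card W) :
    ∃ S : Finset (Sym2 V), (S : Set (Sym2 V)) ⊆ G.edgeSet ∧
      (S.card : ℝ) ≤ ε * (Fintype.card V : ℝ) ^ 2 ∧
      H.Free (G.deleteEdges (S : Set (Sym2 V))) := by
  set f := ⌊5 * (Fintype.card W : ℝ) ^ 4 * Real.log ε⁻¹⌋₊ with hf
  have hT : (0 : ℝ) < towerOfTwos f := by
    exact_mod_cast lt_of_le_of_lt (Nat.zero_le f) (GraphRemoval.lt_towerOfTwos f)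
  have hG' : (towerOfTwos f : ℝ) * G.copyCount H ≤ (Fintype.card V : ℝ) ^ Fintype.card W := by
    rw [← inv_inv δ, hδ, ← div_eq_inv_mul, le_div_iff₀ hT] at hG
    linarith
  by_cases hbot : H = ⊥
  · subst hbot
    -- Deletions cannot destroy copies of an edgeless graph, so `G` itself must be free.
    refine ⟨∅, by simp, ?_, ?_⟩
    · simp only [Finset.card_empty, Nat.cast_zero]
      positivity
    · simpa using GraphRemoval.free_of_bot hε0 (hH rfl) hf G hG'
  · exact GraphRemoval.removal_of_ne_bot hbot hε0 hf G hG'
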